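/- **Torus algebra.** Let $A$ be the $\mathbb F_2[U]$-module with basis the idempotents $\iota_0,\iota_1$ and the chords $\rho_{i,i+1,\dots,i+l}$ ($i\in\mathbb Z/4$, $l\ge 0$), i.e. $\mathbb F_2[U]$ tensored with the path algebra with arrows $\rho_1,\rho_3\colon\iota_0\to\iota_1$ and $\rho_2,\rho_4\colon\iota_1\to\iota_0$ and relations $\rho_2\rho_1=\rho_3\rho_2=\rho_4\rho_3=\rho_1\rho_4=0$ (paths are read from left to right). The weighted algebra $\mathcal A_-$ of the torus is $A$ with the $\mathbb F_2[U]$-multilinear operations $\mu_n^w\colon A^{\otimes n}\to A$ for which: $\mu_2^0$ is the multiplication; $\mu_0^1=\rho_{1234}+\rho_{2341}+\rho_{3412}+\rho_{4123}$; $\mu_0^w=0$ for $w\ne1$; and for all other $(n,w)$ and chords $\rho^1,\dots,\rho^n$, $$\mu_n^w(\rho^1,\dots,\rho^n)=N(\rho^1,\dots,\rho^n;w)\,U^k\iota+\sum_{\rho^1=\rho b}N(b,\rho^2,\dots,\rho^n;w)\,U^k\rho+\sum_{\rho^n=b\rho}N(\rho^1,\dots,\rho^{n-1},b;w)\,U^k\rho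 ,$$ while such a $\mu_n^w$ vanishes if some input is an idempotent. Here $\iota$ is the initial idempotent of $\rho^1$, $2k+2=n+2w$, and $N(\rho^1,\dots,\rho^n;w)$ is the number, modulo $2$, of isomorphism classes of disks with a base point on the boundary that are tiled by $k$ unit squares, with $w$ interior vertices at each of which exactly four squares meet, and $n$ boundary vertices whose successive chords, starting at the base point, are $\rho^1,\dots,\rho^n$ (equivalently, immersions of a disk in the square torus, possibly branched at boundary vertices). Each square has its corners labelled $\rho_4,\rho_3,\rho_2,\rho_1$ in the order of the boundary orientation, with squares glued by translations of the plane. Let $\mathcal A_-^{U=1}$ be the result of setting $U=1$ in $\mathcal A_-$. **Diagonals.** A weighted tree is a planar rooted tree with some non-root leaves marked as inputs and a weight in $\mathbb Z_{\ge0}$ on every internal vertex (unmarked leaves being internal); it is stable if internal vertices of valence less than $3$ have positive weight. A tree with $n$ inputs, total weight $w$ and $v$ internal vertices has dimension $n+2w-v-1$. Let $\downarrow$ be the identity tree (one input, no internal vertex) and $\top$ the stump (no input, no internal vertex, dimension $0$). Let $\Psi_n^w$ be the corolla with $n$ inputs and weight $w$. The boundary of a tree $T$ is the sum of all pairs of a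 stable tree $S$ and an internal edge of $S$ such that collapsing the edge, adding the weights of its endpoints, gives $T$; extend it to pairs of trees by the Leibniz rule. $T\circ_iS$ connects the output of $S$ to the $i$-th input of $T$; $\downarrow$ acts as the identity, and, for $T\neq\downarrow$, $T\circ_i\top$ deletes the $i$-th input if it feeds into a vertex of valence $3$ and weight $0$ (which then disappears) and is $0$ otherwise. For pairs with $a$ inputs each, $(S_1,S_2)\circ(T_1,T_2)=\sum_{i=1}^a(S_1\circ_iT_1,S_2\circ_iT_2)$. A weighted algebra diagonal $\Gamma$ consists, for all $n,w\ge0$ with $n+2w\ge2$, of an element $\Gamma^{n,w}$ that is an $\mathbb F_2$-linear combination of terms $Y_1^{w-w_1}Y_2^{w-w_2}\,S\otimes T$, where $S,T$ are stable trees (or $\downarrow$, $\top$) with $n$ inputs, of weights $w_1,w_2\le w$, with $\dim S+\dim T=n+2w-2$ and not both in $\{\downarrow,\top\}$, such that, with $\Gamma^{0,0}=\Gamma^{1,0}=0$, $$\partial\Gamma^{n,x}=\sum_{v+w=x,\ a+b=n+1}\Gamma^{a,v}\circ\Gamma^{b,w},\qquad \Gamma^{2,0}=\Psi_2^0\otimes\Psi_2^0,\qquad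 \Gamma^{0,1}=\Psi_0^1\otimes\Psi_0^1+Y_1\top\otimes\Psi_0^1+Y_2\Psi_0^1\otimes\top .$$ For weighted algebras $\mathcal A,\mathcal B$ on which $Y_1$, $Y_2$ act respectively, a tree $T$ induces an operation $\mu(T)$ by placing $\mu_m^{w(p)}$ at each internal vertex $p$ with $m$ inputs ($\mu(\downarrow)=\mathrm{Id}$, $\mu(\top)=1$), and $\mathcal A\otimes_\Gamma\mathcal B$ is $A\otimes_{\mathbb F_2}B$ with the operations $\mu_n^w=\sum Y_1^{w-w_1}Y_2^{w-w_2}\mu_{\mathcal A}(S)\otimes\mu_{\mathcal B}(T)$, summed over the terms of $\Gamma^{n,w}$ (and $\mu_1^0$ the usual tensor product differential). **Lemma.** Let $P$ be generated by $\iota_0\otimes\iota_0$ and $\iota_1\otimes\iota_1$ (over the tensor product of the two ground rings), with $$\delta^1(\iota_0\otimes\iota_0)=(\rho_1\otimes\rho_3+\rho_3\otimes\rho_1+\rho_{123}\otimes\rho_{123}+\rho_{341}\otimes\rho_{341})\otimes(\iota_1\otimes\iota_1),$$ $$\delta^1(\iota_1\otimes\iota_1)=(\rho_2\otimes\rho_2+\rho_4\otimes\rho_4+\rho_{234}\otimes\rho_{412}+\rho_{412}\otimes\rho_{234})\otimes(\iota_0\otimes\iota_0),$$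 and let $\delta^n$ be the $n$-fold iterate of $\delta^1$. Then for every weighted algebra diagonal $\Gamma$ the weighted type $DD$ structure equation $$\sum_{n,w\ge0}(\mu_n^w\otimes\mathrm{Id})\circ\delta^n=0$$ holds, only finitely many terms of the sum being nonzero, both * over $\mathcal A_-\otimes_\Gamma\mathcal A_-$, where $Y_1=U_1$ and $Y_2=U_2$ are the variables $U$ of the two factors (the bimodule ${}_U\mathit{CFDD}^-(\mathrm{Id})$), and * over $\mathcal A_-^{U=1}\otimes_\Gamma\mathcal A_-$, where $Y_1$ acts by $1$ and $Y_2$ by $U$ (the bimodule $\mathit{CFDD}^-(\mathrm{Id})$). -/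

import Mathlib

open scoped TensorProduct Polynomial

noncomputable section

namespace BorderedTorus

/-- Planar rooted trees with marked inputs and weighted internal vertices. The constructor `input`
is a marked non-root leaf (an input); `node w ts` is an internal vertex of weight `w` whose
subtrees, in planar order, are `ts` (so its valence is `ts.length + 1`, and `node w []` is an
internal leaf). The root (output) edge is attached to the top of the tree. In particular the tree
`input` on its own is the identity tree `↓`, with one input and no internal vertex. -/
inductive WTree : Type
  | input : WTree
  | node (w : ℕ) (ts : List WTree) : WTree

mutual
/-- The number of inputs of a tree. -/
def WTree.inputs : WTree → ℕ
  | .input => 1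
  | .node _ ts => forestInputs ts
/-- The total number of inputs of a list of trees. -/
def forestInputs : List WTree → ℕ
  | [] => 0
  | t :: ts => t.inputs + forestInputs ts
end

mutual
/-- The total weight of a tree. -/
def WTree.weight : WTree → ℕ
  | .input => 0
  | .node w ts => w + forestWeight ts
/-- The total weight of a list of trees. -/
def forestWeight : List WTree → ℕ
  | [] => 0
  | t :: ts => t.weight + forestWeight ts
end

mutual
/-- The number of internal vertices of a tree. -/
def WTree.vertices : WTree → ℕ
  | .input => 0
  | .node _ ts => 1 + forestVertices ts
/-- The number of internal vertices of a list of trees. -/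
def forestVertices : List WTree → ℕ
  | [] => 0
  | t :: ts => t.vertices + forestVertices ts
end

mutual
/-- A weighted tree is stable if each internal vertex of valence less than `3` has positive
weight. -/
def WTree.Stable : WTree → Prop
  | .input => True
  | .node w ts => (ts.length + 1 < 3 → 0 < w) ∧ ForestStable ts
/-- All trees of the list are stable. -/
def ForestStable : List WTree → Prop
  | [] => True
  | t :: ts => t.Stable ∧ ForestStable ts
end

mutual
/-- The list of all trees obtained from a tree by collapsing one edge between two internal
vertices (and adding the weights of its two endpoints), one entry for each such edge. -/
def WTree.collapses : WTree → List WTree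
  | .input => []
  | .node w ts => (forestCollapses ts).map fun p => .node (w + p.1) p.2
/-- The collapses of an edge in, or directly above, a list of trees that are the subtrees of a
common vertex: each entry consists of the weight which is added to the common vertex and of its new
list of subtrees. -/
def forestCollapses : List WTree → List (ℕ × List WTree)
  | [] => []
  | t :: ts =>
      (match t with
        | .input => []
        | .node w us => [(w, us ++ ts)])
      ++ (t.collapses.map fun t' => (0, t' :: ts))
      ++ ((forestCollapses ts).map fun p => (p.1, t :: p.2))
end

mutual
/-- `graft T i S` connects the output of `S` to the `i`-th input of `T` (inputs are numbered from
`0`). -/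
def WTree.graft : WTree → ℕ → WTree → WTree
  | .input, _, S => S
  | .node w ts, i, S => .node w (forestGraft ts i S)
/-- Grafting into a list of trees. -/
def forestGraft : List WTree → ℕ → WTree → List WTree
  | [], _, _ => []
  | t :: ts, i, S =>
      if i < t.inputs then t.graft i S :: ts else t :: forestGraft ts (i - t.inputs) S
end

/-- If `w = 0`, if `ts` consists of two trees, and if one of them is the input number `i`, then
the other one. -/
def pruneHere (w : ℕ) (ts : List WTree) (i : ℕ) : Option WTree :=
  match w, ts with
  | 0, [.input, b] => if i = 0 then some b else
      match b with
      | .input => if i = 1 then some .input else none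
      | .node _ _ => none
  | 0, [a, .input] => if i = a.inputs then some a else none
  | _, _ => none

mutual
/-- Deletion of the `i`-th input, that is, composition with the stump: it is defined if the `i`-th
input feeds into a vertex of valence `3` and weight `0`, which then disappears as well. The value
`none` stands for the zero composition. -/
def WTree.prune : WTree → ℕ → Option WTree
  | .input, _ => none
  | .node w ts, i =>
      match pruneHere w ts i with
      | some r => some r
      | none => (forestPrune ts i).map fun us => .node w us
/-- Deletion of the `i`-th input inside one of the trees of a list. -/
def forestPrune : List WTree → ℕ → Option (List WTree)
  | [], _ => none
  | t :: ts, i =>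
      if i < t.inputs then (t.prune i).map fun t' => t' :: ts
      else (forestPrune ts (i - t.inputs)).map fun us => t :: us
end

/-- Weighted trees together with the stump `⊤`, which has no inputs and no internal vertices. -/
inductive GTree : Type
  | stump : GTree
  | tree (t : WTree) : GTree

namespace GTree

/-- Number of inputs. -/
def inputs : GTree → ℕ
  | stump => 0
  | tree t => t.inputs

/-- Total weight. -/
def weight : GTree → ℕ
  | stump => 0
  | tree t => t.weight

/-- Stability; both degenerate trees `↓` and `⊤` are admitted. -/
def Stable : GTree → Prop
  | stump => True
  | tree t => t.Stable

/-- The dimension `n + 2 w - v - 1`; the stump has dimension `0`, as it must for composition of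
trees to add dimensions. -/
def dim : GTree → ℤ
  | stump => 0
  | tree t => t.inputs + 2 * t.weight - t.vertices - 1

/-- The degenerate trees are the stump and the identity tree. -/
def Degenerate : GTree → Prop
  | stump => True
  | tree .input => True
  | tree (.node _ _) => False

/-- Edge collapses; the degenerate trees have no internal edge. -/
def collapses : GTree → List GTree
  | stump => []
  | tree t => t.collapses.map tree

/-- The composition `T ∘ᵢ S`; `none` stands for zero. -/
def comp : GTree → ℕ → GTree → Option GTree
  | stump, _, _ => none
  | tree .input, _, S => some S
  | tree (.node w ts), i, tree S => some (tree ((WTree.node w ts).graft i S))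
  | tree (.node w ts), i, stump => ((WTree.node w ts).prune i).map tree

/-- The corolla with `n` inputs and weight `w`. -/
def corolla (n w : ℕ) : GTree := tree (.node w (List.replicate n .input))

end GTree

/-- Formal sums of pairs of trees with coefficients in `𝔽₂`. -/
abbrev PairChain : Type := GTree × GTree →₀ ZMod 2

/-- The coefficient of the stable pair `(S, T)` in the boundary `∂c`. The differential of a tree is
the sum of all pairs of a stable tree and an internal edge of it whose collapse is the given tree,
and `∂ (S ⊗ T) = ∂S ⊗ T + S ⊗ ∂T`. -/
def boundaryCoeff (c : PairChain) (p : GTree × GTree) : ZMod 2 :=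
  (p.1.collapses.map fun S => c (S, p.2)).sum + (p.2.collapses.map fun T => c (p.1, T)).sum

/-- `(S₁, S₂) ∘ᵢ (T₁, T₂) = (S₁ ∘ᵢ T₁, S₂ ∘ᵢ T₂)`. -/
def compPair (p : GTree × GTree) (i : ℕ) (q : GTree × GTree) : PairChain :=
  match p.1.comp i q.1, p.2.comp i q.2 with
  | some S, some T => Finsupp.single (S, T) 1
  | _, _ => 0

/-- The composition of a sum of pairs of trees with `n` inputs each with a sum of pairs of trees:
`(S₁, S₂) ∘ (T₁, T₂) = ∑ᵢ (S₁ ∘ᵢ T₁, S₂ ∘ᵢ T₂)`, extended bilinearly. -/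
def compChain (n : ℕ) (c d : PairChain) : PairChain :=
  c.sum fun p a => d.sum fun q b => (a * b) • ∑ i ∈ Finset.range n, compPair p i q

/-- Weighted algebra diagonals. The coefficient in `𝔽₂[Y₁, Y₂]` of a pair `(S, T)` in the
`n`-input weight `w` cell is required to be a multiple of the monomial
`Y₁ ^ (w - weight S) * Y₂ ^ (w - weight T)`, so it is recorded by its coefficient
`cell n w (S, T)` in `𝔽₂`; as composition and edge collapse respect total weights, the powers of
`Y₁` and `Y₂` agree automatically on both sides of the compatibility relation. The cells exist for
`2 ≤ n + 2 * w` and are zero, by convention, otherwise. -/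
structure WeightedAlgebraDiagonal where
  cell : ℕ → ℕ → PairChain
  cell_eq_zero : ∀ n w, n + 2 * w < 2 → cell n w = 0
  mem : ∀ n w, ∀ p ∈ (cell n w).support,
    (p.1.Stable ∧ p.1.inputs = n ∧ p.1.weight ≤ w) ∧
    (p.2.Stable ∧ p.2.inputs = n ∧ p.2.weight ≤ w) ∧
    p.1.dim + p.2.dim = n + 2 * w - 2
  /-- `∂ Γ^{n,x} = ∑ Γ^{a,v} ∘ Γ^{b,w}` over `v + w = x` and `a + b = n + 1`. -/
  compat : ∀ n x, 2 ≤ n + 2 * x → ∀ p : GTree × GTree, p.1.Stable → p.2.Stable →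
    boundaryCoeff (cell n x) p =
      ∑ v ∈ Finset.HasAntidiagonal.antidiagonal x, ∑ a ∈ Finset.HasAntidiagonal.antidiagonal (n + 1),
        compChain a.1 (cell a.1 v.1) (cell a.2 v.2) p
  cell_two_zero : cell 2 0 = Finsupp.single (GTree.corolla 2 0, GTree.corolla 2 0) 1
  cell_zero_one : cell 0 1 =
    Finsupp.single (GTree.corolla 0 1, GTree.corolla 0 1) 1
      + Finsupp.single (GTree.stump, GTree.corolla 0 1) 1
      + Finsupp.single (GTree.corolla 0 1, GTree.stump) 1
  not_both_degenerate : ∀ n w, ∀ p ∈ (cell n w).support, ¬ (p.1.Degenerate ∧ p.2.Degenerate)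

/-- The pair `(i, l)` stands for the Reeb chord `ρ_{i, i+1, …, i+l}` of length `l + 1`, which runs
from the point `a_i` to the point `a_{i+l+1}`; indices are taken modulo `4`, so `ρ_4` has index
`0`. -/
abbrev Chord : Type := ZMod 4 × ℕ

/-- The arc which contains the point `a_i`: `a_1, a_3` lie on the arc number `0` and `a_2, a_4` on
the arc number `1`. -/
def arc (i : ZMod 4) : Fin 2 := if i = 1 ∨ i = 3 then 0 else 1

/-- The nonzero paths in the quiver of the torus algebra modulo the relations
`ρ₂ρ₁ = ρ₃ρ₂ = ρ₄ρ₃ = ρ₁ρ₄ = 0`: the idempotents `ι₀, ι₁` and the chords `ρ_{i, …, i+l}`. -/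
inductive Path : Type
  | idem (i : Fin 2) : Path
  | chord (i : ZMod 4) (l : ℕ) : Path

namespace Path

/-- Initial vertex. -/
def src : Path → Fin 2
  | idem i => i
  | chord i _ => arc i

/-- Terminal vertex. -/
def tgt : Path → Fin 2
  | idem i => i
  | chord i l => arc (i + l + 1)

/-- Concatenation of paths, read from left to right; `none` stands for the product `0`. -/
def mul : Path → Path → Option Path
  | idem i, y => if y.src = i then some y else none
  | chord i l, idem j => if (chord i l).tgt = j then some (chord i l) else none
  | chord i l, chord j m => if j = i + l + 1 then some (chord i (l + m + 1)) else none

/-- The chord given by a path, if it is not an idempotent. -/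
def toChord : Path → Option Chord
  | idem _ => none
  | chord i l => some (i, l)

end Path

/-- The displacement of the neighbouring unit square across the side `s` of a unit square in the
plane: the sides number `0` (which is number `4`), `1`, `2`, `3` are the left, top, right and bottom
side. -/
def shift (s : ZMod 4) : ℤ × ℤ :=
  if s = 0 then (-1, 0) else if s = 1 then (0, 1) else if s = 2 then (1, 0) else (0, -1)

/-- A surface tiled by `k` unit squares, together with a map to the plane (the universal cover of
the torus tiled by a single square) which sends tiles to tiles. The tile across the side `s` of `t`
is `nb t s`, and `nb t s = none` if this side lies on the boundary. The corner number `j` of a tile,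
corresponding to the chord `ρ_j`, lies between the sides `j` and `j - 1`: numbers `0` (that is, `4`),
`3`, `2`, `1` are the lower left, lower right, upper right and upper left corners. -/
structure Tiling (k : ℕ) where
  nb : Fin k → ZMod 4 → Option (Fin k)
  symm : ∀ t s t', nb t s = some t' → nb t' (s + 2) = some t
  develops : ∃ pos : Fin k → ℤ × ℤ, ∀ t s t', nb t s = some t' → pos t' = pos t + shift s

namespace Tiling

variable {k : ℕ}

/-- The side through which one leaves the corner `c`, turning clockwise around its vertex, is on the
boundary. -/
def IsLast (T : Tiling k) (c : Fin k × ZMod 4) : Prop := T.nb c.1 (c.2 - 1) = none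

/-- The corner after `c`, where we turn clockwise around the vertex of `c` into the next tile, and,
if there is a boundary side instead, follow this side to its other end and proceed with the corner
there. Thus the corners are traversed along the boundary with the surface on the left, and all
corners at an interior vertex form a cycle. -/
def step (T : Tiling k) (c : Fin k × ZMod 4) : Fin k × ZMod 4 :=
  match T.nb c.1 (c.2 - 1) with
  | some t => (t, c.2 + 1)
  | none => (c.1, c.2 - 1)

end Tiling

/-- The corners which a sequence of chords runs through: the indices of the short chords in it, and
whether they are the last one in their chord. -/
def letters (word : List Chord) : List (ZMod 4 × Bool) :=
  word.flatMap fun c => (List.range (c.2 + 1)).map fun m => (c.1 + (m : ZMod 4), m == c.2)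

/-- The tiled surface `T` is a disk whose interior vertices lie on exactly four tiles each and are
`w` in number, and the chords around its boundary vertices, in the order of the boundary orientation
and starting from the corner `c₀`, are `word`. -/
structure IsDisk {k : ℕ} (T : Tiling k) (c₀ : Fin k × ZMod 4) (word : List Chord) (w : ℕ) :
    Prop where
  connected : ∀ t, Relation.ReflTransGen (fun a b => ∃ s, T.nb a s = some b) c₀.1 t
  reads : ∀ p (hp : p < (letters word).length),
    (T.step^[p] c₀).2 = ((letters word)[p]).1 ∧
      (T.IsLast (T.step^[p] c₀) ↔ ((letters word)[p]).2 = true)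
  closed : T.step^[(letters word).length] c₀ = c₀
  once : Set.InjOn (fun p => T.step^[p] c₀) (Set.Iio (letters word).length)
  /-- every corner which is not on this boundary component is at an interior vertex with exactly
  four corners -/
  interior : ∀ c, (∀ p < (letters word).length, T.step^[p] c₀ ≠ c) →
    T.step^[4] c = c ∧ ∀ r < 4, ¬ T.IsLast (T.step^[r] c)
  /-- there are `w` interior vertices -/
  interior_count : (letters word).length + 4 * w = 4 * k
  /-- the Euler characteristic `(n + w) - (4 * k + n) / 2 + k` is `1`, where `n` is the number of
  boundary vertices -/
  euler : word.length + 2 * w = 2 * k + 2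

/-- Tiled disks with `k` tiles, `w` interior vertices and a base corner from which the chords are
`word`. -/
abbrev BasedDisk (k : ℕ) (word : List Chord) (w : ℕ) : Type :=
  {D : Tiling k × (Fin k × ZMod 4) // IsDisk D.1 D.2 word w}

/-- Isomorphism of based tiled disks (an equivalence relation). -/
def BasedDisk.Iso {k : ℕ} {word : List Chord} {w : ℕ} (D E : BasedDisk k word w) : Prop :=
  ∃ σ : Equiv.Perm (Fin k), (∀ t s, E.1.1.nb (σ t) s = (D.1.1.nb t s).map σ) ∧
    E.1.2 = (σ D.1.2.1, D.1.2.2)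

/-- The number of tiles of a disk with `n` boundary vertices and `w` interior vertices. -/
def tileCount (n w : ℕ) : ℕ := (n + 2 * w) / 2 - 1

/-- The number of isomorphism classes of tiled disks with boundary chords `word` and `w` interior
vertices, i.e. of immersions of a disk in the torus, branched at most at the boundary vertices. -/
def diskCount (word : List Chord) (w : ℕ) : ℕ :=
  Nat.card (Quot (BasedDisk.Iso (k := tileCount word.length w) (word := word) (w := w)))

section Algebra

variable {R : Type} [CommRing R]

/-- The underlying module of the torus algebra: for `R = 𝔽₂[U]` this is the tensor product over
`𝔽₂` of `𝔽₂[U]` with the path algebra with relations. -/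
abbrev Alg (R : Type) [CommRing R] : Type := Path →₀ R

/-- The operation of weight `w` counting disks, on a sequence of chords. The first summand is the
centered operation `U ^ k ι`, the others are its extensions by a chord `ρ` to the left or to the
right: the first input is factored as `ρ b`, respectively the last input as `b ρ`. -/
def diskOp (u : R) (w : ℕ) (word : List Chord) : Alg R :=
  match word with
  | [] => 0
  | (i, l) :: rest =>
    let k := tileCount ((i, l) :: rest).length w
    let init := ((i, l) :: rest).dropLast
    let z : Chord := ((i, l) :: rest).getLast (List.cons_ne_nil _ _)
    Finsupp.single (Path.idem (arc i)) ((diskCount ((i, l) :: rest) w : R) * u ^ k)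
    + ∑ m ∈ Finset.range l, Finsupp.single (Path.chord i m)
        ((diskCount ((i + m + 1, l - (m + 1)) :: rest) w : R) * u ^ k)
    + ∑ m ∈ Finset.range z.2, Finsupp.single (Path.chord (z.1 + m + 1) (z.2 - (m + 1)))
        ((diskCount (init ++ [(z.1, m)]) w : R) * u ^ k)

/-- The operation of weight `w` on a sequence of basis elements, where `U` acts as `u`: `μ₂⁰` is
the multiplication of paths, `μ₀¹` is the sum of the four chords of length `4`, and all other
operations count disks (they vanish if one of the inputs is an idempotent). -/
def basisOp (u : R) (w : ℕ) (bs : List Path) : Alg R :=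
  match w, bs with
  | 0, [x, y] =>
    match x.mul y with
    | some z => Finsupp.single z 1
    | none => 0
  | 1, [] => ∑ i : ZMod 4, Finsupp.single (Path.chord i 3) 1
  | w, bs =>
    match bs.mapM Path.toChord with
    | some word => diskOp u w word
    | none => 0

/-- Multilinear extension of a function of finite sequences of basis elements. -/
def extend (f : List Path → Alg R) : List (Alg R) → Alg R
  | [] => f []
  | a :: as => a.sum fun b r => r • extend (fun bs => f (b :: bs)) as

/-- The operation `μₙʷ` of the weighted torus algebra, where `n` is the number of the inputs in the
list. With `R = 𝔽₂[U]` and `u = U` this is the weighted algebra of the torus, and with `R = 𝔽₂` and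
`u = 1` it is the result of setting `U = 1` in it. -/
def mu (u : R) (w : ℕ) (as : List (Alg R)) : Alg R := extend (basisOp u w) as

/-- The idempotent `ι_i` as an element of the algebra. -/
def iota (R : Type) [CommRing R] (i : Fin 2) : Alg R := Finsupp.single (Path.idem i) 1

/-- The chord `ρ_{i, …, i+l}` as an element of the algebra. -/
def rho (R : Type) [CommRing R] (i : ZMod 4) (l : ℕ) : Alg R := Finsupp.single (Path.chord i l) 1

mutual
/-- The operation `μ(T)` induced by a tree. -/
def WTree.eval (u : R) : WTree → List (Alg R) → Alg R
  | .input, as => as.headD 0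
  | .node w ts, as => mu u w (forestEval u ts as)
/-- The list of the values of the trees of a list on consecutive blocks of inputs. -/
def forestEval (u : R) : List WTree → List (Alg R) → List (Alg R)
  | [], _ => []
  | t :: ts, as => t.eval u (as.take t.inputs) :: forestEval u ts (as.drop t.inputs)
end

/-- The operation induced by a possibly degenerate tree; the stump gives the unit `ι₀ + ι₁`. -/
def GTree.eval (u : R) : GTree → List (Alg R) → Alg R
  | .stump, _ => iota R 0 + iota R 1
  | .tree t, as => t.eval u as

end Algebra

section DD

variable {R₁ R₂ X : Type} [CommRing R₁] [CommRing R₂] [Algebra (ZMod 2) R₁] [Algebra (ZMod 2) R₂]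

/-- The data of a type `DD` bimodule over two versions of the torus algebra, with generators `X`.
The generator `x` satisfies `x = (ι_i ⊗ ι_j) x` with `(i, j) = idem x`, and the structure map is
`δ¹ x = ∑ (a ⊗ b) ⊗ y`, the sum over the entries `(a, b, y)` of the list `delta x`. It is compatible
with the idempotents. -/
structure DDData (R₁ R₂ X : Type) [CommRing R₁] [CommRing R₂] where
  idem : X → Fin 2 × Fin 2
  delta : X → List (Alg R₁ × Alg R₂ × X)
  left_idem : ∀ x, ∀ p ∈ delta x, ∀ b ∈ p.1.support,
    b.src = (idem x).1 ∧ b.tgt = (idem p.2.2).1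
  right_idem : ∀ x, ∀ p ∈ delta x, ∀ b ∈ p.2.1.support,
    b.src = (idem x).2 ∧ b.tgt = (idem p.2.2).2

/-- The iterated structure map `δⁿ x = ∑ (a₁ ⊗ b₁) ⊗ ⋯ ⊗ (aₙ ⊗ bₙ) ⊗ y` as a list of its terms. -/
def DDData.iter (D : DDData R₁ R₂ X) : ℕ → X → List (List (Alg R₁ × Alg R₂) × X)
  | 0, x => [([], x)]
  | n + 1, x => (D.delta x).flatMap fun p =>
      (D.iter n p.2.2).map fun q => ((p.1, p.2.1) :: q.1, q.2)

/-- The element `(c ⊗ d) (ι_i ⊗ ι_j)`, with `e = (i, j)`. Tensoring over the ground rings with a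
generator of idempotent `(i, j)` identifies `c ⊗ d` with this element. -/
def tensorAt (u₁ : R₁) (u₂ : R₂) (e : Fin 2 × Fin 2) (c : Alg R₁) (d : Alg R₂) :
    Alg R₁ ⊗[ZMod 2] Alg R₂ :=
  mu u₁ 0 [c, iota R₁ e.1] ⊗ₜ[ZMod 2] mu u₂ 0 [d, iota R₂ e.2]

/-- The term `Y₁ ^ (w - weight S) Y₂ ^ (w - weight T) μ(S) ⊗ μ(T)`, where `Y₁` and `Y₂` act as
the two elements `u₁` and `u₂`, applied to a sequence of pairs and tensored with a generator of
idempotent `e`. -/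
def pairOp (u₁ : R₁) (u₂ : R₂) (w : ℕ) (p : GTree × GTree) (as : List (Alg R₁ × Alg R₂))
    (e : Fin 2 × Fin 2) : Alg R₁ ⊗[ZMod 2] Alg R₂ :=
  tensorAt u₁ u₂ e (u₁ ^ (w - p.1.weight) • p.1.eval u₁ (as.map Prod.fst))
    (u₂ ^ (w - p.2.weight) • p.2.eval u₂ (as.map Prod.snd))

/-- The operation of weight `w` of the tensor product of the two algebras with respect to the
diagonal `Γ`, applied to a sequence of pairs and tensored with a generator of idempotent `e`. For one
input and weight zero it is the usual differential on the tensor product. -/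
def tensorOp (Γ : WeightedAlgebraDiagonal) (u₁ : R₁) (u₂ : R₂) (w : ℕ)
    (as : List (Alg R₁ × Alg R₂)) (e : Fin 2 × Fin 2) : Alg R₁ ⊗[ZMod 2] Alg R₂ :=
  match w, as with
  | 0, [(a, b)] => tensorAt u₁ u₂ e (mu u₁ 0 [a]) b + tensorAt u₁ u₂ e a (mu u₂ 0 [b])
  | w, as => (Γ.cell as.length w).sum fun p c => c • pairOp u₁ u₂ w p as e

/-- The term `(μₙʷ ⊗ Id) (δⁿ x)` of the structure equation, as a function on the generators: the
value at `y` is the coefficient of `y`, an element of `(A ⊗ B) (ι_i ⊗ ι_j)` for `(i, j)` the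
idempotent of `y`. -/
def DDData.structureTerm [DecidableEq X] (D : DDData R₁ R₂ X) (Γ : WeightedAlgebraDiagonal)
    (u₁ : R₁) (u₂ : R₂) (n w : ℕ) (x : X) : X → Alg R₁ ⊗[ZMod 2] Alg R₂ :=
  ((D.iter n x).map fun q => Pi.single q.2 (tensorOp Γ u₁ u₂ w q.1 (D.idem q.2))).sum

/-- The weighted type `DD` structure equation `∑_{n, w ≥ 0} (μₙʷ ⊗ Id) ∘ δⁿ = 0` with respect to
the diagonal `Γ`, including the assertion that the sum is finite: for each generator `x` and all but
finitely many `(n, w)`, each pair of trees in the diagonal contributes zero on each term of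
`δⁿ x`. -/
def DDData.StructureEquation [DecidableEq X] (D : DDData R₁ R₂ X) (Γ : WeightedAlgebraDiagonal)
    (u₁ : R₁) (u₂ : R₂) : Prop :=
  ∀ x : X,
    {m : ℕ × ℕ | ∃ q ∈ D.iter m.1 x, ∃ p ∈ (Γ.cell m.1 m.2).support,
      pairOp u₁ u₂ m.2 p q.1 (D.idem q.2) ≠ 0}.Finite ∧
    ∑ᶠ m : ℕ × ℕ, D.structureTerm Γ u₁ u₂ m.1 m.2 x = 0

/-- The dualizing bimodule, with generators `0` and `1` for `ι₀ ⊗ ι₀` and `ι₁ ⊗ ι₁` and with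
`δ¹(ι₀ ⊗ ι₀) = (ρ₁ ⊗ ρ₃ + ρ₃ ⊗ ρ₁ + ρ₁₂₃ ⊗ ρ₁₂₃ + ρ₃₄₁ ⊗ ρ₃₄₁) ⊗ (ι₁ ⊗ ι₁)`,
`δ¹(ι₁ ⊗ ι₁) = (ρ₂ ⊗ ρ₂ + ρ₄ ⊗ ρ₄ + ρ₂₃₄ ⊗ ρ₄₁₂ + ρ₄₁₂ ⊗ ρ₂₃₄) ⊗ (ι₀ ⊗ ι₀)`. -/
def dualizingBimodule (R₁ R₂ : Type) [CommRing R₁] [CommRing R₂] : DDData R₁ R₂ (Fin 2) where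
  idem x := (x, x)
  delta x :=
    if x = 0 then
      [(rho R₁ 1 0, rho R₂ 3 0, 1), (rho R₁ 3 0, rho R₂ 1 0, 1),
        (rho R₁ 1 2, rho R₂ 1 2, 1), (rho R₁ 3 2, rho R₂ 3 2, 1)]
    else
      [(rho R₁ 2 0, rho R₂ 2 0, 0), (rho R₁ 4 0, rho R₂ 4 0, 0),
        (rho R₁ 2 2, rho R₂ 4 2, 0), (rho R₁ 4 2, rho R₂ 2 2, 0)]
  left_idem := by
    intro x p hp b hb
    fin_cases x <;> simp at hp <;> rcases hp with rfl | rfl | rfl | rfl <;>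
      (have hb' := Finsupp.support_single_subset hb
       rw [Finset.mem_singleton] at hb'
       subst hb'
       exact ⟨rfl, rfl⟩)
  right_idem := by
    intro x p hp b hb
    fin_cases x <;> simp at hp <;> rcases hp with rfl | rfl | rfl | rfl <;>
      (have hb' := Finsupp.support_single_subset hb
       rw [Finset.mem_singleton] at hb'
       subst hb'
       exact ⟨rfl, rfl⟩)

end DD

/-- The bimodule `_U CFDD⁻(Id)` over two copies of the torus algebra over `𝔽₂[U]`. -/
def uCFDD : DDData (ZMod 2)[X] (ZMod 2)[X] (Fin 2) := dualizingBimodule _ _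

/-- The bimodule `CFDD⁻(Id)` over the torus algebra with `U = 1` and the torus algebra. -/
def CFDD : DDData (ZMod 2) (ZMod 2)[X] (Fin 2) := dualizingBimodule _ _

end BorderedTorus

end

open scoped TensorProduct Polynomial

noncomputable section

namespace BorderedTorus

-- Chords are graded in a Heisenberg-type monoid: multiplicities in `ℤ^4`, extended by a Maslov
-- component twisted by the skew form `link`. The geometric input is `IsDisk.grading`: the gradings
-- of the chords around a disk with `k` tiles and `w` interior vertices multiply to the central
-- element `central k w`. It follows by developing the disk into the plane and evaluating a discrete
-- area-like double sum over all corners. All operations are therefore homogeneous. So are their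
-- compositions along a tree, where the total exponent `K` of `U` is half the dimension of the tree
-- (`GTree.eval_grading`).
--
-- In every term of `δ¹` the second chord has the multiplicities of the first one reflected by `j ↦
-- -j`. The reflection changes the sign of `link`, so in a product of such terms the twists of the
-- two sides cancel and the Maslov components add up to `-2` per term. Comparison with the gradings
-- of the outputs leaves the relation `n + m + 4w = 4` (`grading_constraints`), where `n + m` is the
-- total length of the chords on the left side. As `m` is even, only `(n, w) = (0, 1), (2, 0), (4,
-- 0)` can contribute. This gives the finiteness, and for `n = 4` it forces all chords to be short.
--
-- A diagonal is not unique, but what is needed of it is. For `n = 4` homogeneity leaves only pairs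
-- formed by a binary tree and a corolla. All five binary trees induce the same fourfold product, so
-- only the sum of their coefficients matters, and the compatibility relations force it to be `1` on
-- each side (`sum_cell_four_left`, `sum_cell_four_right`). The corolla contributes the operation of
-- a single square (`diskCount_square`).
--
-- With `ρ` the sum of the length-four chords starting at the idempotent `ι` in question, the
-- curvature gives `ρ ⊗ ρ + Uι ⊗ ρ + ρ ⊗ Uι`, the product gives `ρ ⊗ ρ`, and the fourfold operation
-- gives `ρ ⊗ Uι + Uι ⊗ ρ`; the sum vanishes in characteristic two. Nothing depends on how `U` acts
-- on either side, so both bimodules are covered by one statement.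

-- The twisted grading monoid.

/-- Gradings of chords: a Maslov component (doubled, so as to be an integer) and the multiplicities
of the four short chords. -/
@[ext] structure Grading where
  maslov : ℤ
  mult : ZMod 4 → ℤ

/-- The skew bilinear form which twists the product of gradings. -/
def link (x y : ZMod 4 → ℤ) : ℤ := ∑ i, x i * (y (i + 1) - y (i - 1))

theorem link_add_left (x y z : ZMod 4 → ℤ) : link (x + y) z = link x z + link y z := by
  simp [link, add_mul, Finset.sum_add_distrib]

theorem link_add_right (x y z : ZMod 4 → ℤ) : link x (y + z) = link x y + link x z := by
  simp only [link, ← Finset.sum_add_distrib, Pi.add_apply]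
  exact Finset.sum_congr rfl fun i _ => by ring

theorem sum_zmod_four (f : ZMod 4 → ℤ) : ∑ i, f i = f 0 + f 1 + f 2 + f 3 := Fin.sum_univ_four f

theorem link_single_right (x : ZMod 4 → ℤ) (j : ZMod 4) :
    link x (Pi.single j 1) = x (j - 1) - x (j + 1) := by
  have h1 : ∀ i : ZMod 4, i + 1 = j ↔ i = j - 1 := fun i => eq_sub_iff_add_eq.symm
  have h2 : ∀ i : ZMod 4, i - 1 = j ↔ i = j + 1 := fun i => sub_eq_iff_eq_add
  simp [link, Pi.single_apply, mul_sub, Finset.sum_sub_distrib, h1, h2]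

/-- Both shifts of `y` have the same sum over the cyclic group. Constant multiplicities thus lie in
the kernel of `link`, which makes the elements `central k w` central. -/
theorem link_const_left (a : ℤ) (y : ZMod 4 → ℤ) : link (fun _ => a) y = 0 := by
  have h1 : ∑ i, y (i + 1) = ∑ i, y i := Equiv.sum_comp (Equiv.addRight (1 : ZMod 4)) y
  have h2 : ∑ i, y (i - 1) = ∑ i, y i := Equiv.sum_comp (Equiv.subRight (1 : ZMod 4)) y
  rw [link, ← Finset.mul_sum, Finset.sum_sub_distrib, h1, h2, sub_self, mul_zero]

theorem link_const_right (a : ℤ) (y : ZMod 4 → ℤ) : link y (fun _ => a) = 0 := by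
  simp [link]

namespace Grading

instance : One Grading := ⟨⟨0, 0⟩⟩

instance : Mul Grading := ⟨fun g h => ⟨g.maslov + h.maslov + link g.mult h.mult, g.mult + h.mult⟩⟩

@[simp] theorem one_maslov : (1 : Grading).maslov = 0 := rfl
@[simp] theorem one_mult : (1 : Grading).mult = 0 := rfl
@[simp] theorem mul_maslov (g h : Grading) :
    (g * h).maslov = g.maslov + h.maslov + link g.mult h.mult := rfl
@[simp] theorem mul_mult (g h : Grading) : (g * h).mult = g.mult + h.mult := rfl

instance : Monoid Grading where
  mul_assoc a b c := by
    ext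
    · simp only [mul_maslov, mul_mult, link_add_left, link_add_right]; ring
    · simp [add_assoc]
  one_mul a := by
    ext
    · simp [link]
    · simp
  mul_one a := by
    ext
    · simp [link]
    · simp

/-- The grading of the short chord `ρ_i`. -/
def letter (i : ZMod 4) : Grading := ⟨-1, Pi.single i 1⟩

/-- The grading of `U ^ k` in weight `w`; it is central. -/
def central (k w : ℤ) : Grading := ⟨-6 * k + 2 * w, fun _ => k - w⟩

theorem central_comm (k w : ℤ) (g : Grading) : central k w * g = g * central k w := by
  ext
  · simp [central, link_const_left, link_const_right, add_comm]
  · simp [central, add_comm]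

theorem central_add (k w k' w' : ℤ) : central k w * central k' w' = central (k + k') (w + w') := by
  ext
  · simp [central, link_const_left]; ring
  · simp [central]; ring

@[simp] theorem central_zero : central 0 0 = 1 := by
  ext <;> simp [central]

end Grading

-- Gradings of words, letter by letter.

/-- The grading of a chord. -/
def Chord.grading (c : Chord) : Grading :=
  ((List.range (c.2 + 1)).map fun m : ℕ => Grading.letter (c.1 + (m : ZMod 4))).prod

theorem prod_letters (word : List Chord) :
    ((letters word).map fun x => Grading.letter x.1).prod = (word.map Chord.grading).prod := by
  induction word with
  | nil => rfl
  | cons c word ih =>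
    have h : letters (c :: word) =
        ((List.range (c.2 + 1)).map fun m : ℕ => (c.1 + (m : ZMod 4), (m : ZMod 4) == (c.2 : ZMod 4))) ++
          letters word := by
      simp [letters, ← List.map_eq_flatMap, Function.comp_def]
    rw [h, List.map_append, List.prod_append, ih, List.map_cons, List.prod_cons, List.map_map]
    rfl

/-- The grading of the product of the first `N` letters of a sequence. -/
def wordGrading (f : ℕ → ZMod 4) (N : ℕ) : Grading :=
  ((List.range N).map fun p => Grading.letter (f p)).prod

theorem wordGrading_succ (f : ℕ → ZMod 4) (N : ℕ) :
    wordGrading f (N + 1) = wordGrading f N * Grading.letter (f N) := by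
  simp [wordGrading, List.range_succ]

theorem wordGrading_mult (f : ℕ → ZMod 4) (N : ℕ) (j : ZMod 4) :
    (wordGrading f N).mult j = ∑ p ∈ Finset.range N, if f p = j then 1 else 0 := by
  induction N with
  | zero => simp [wordGrading]
  | succ N ih =>
    rw [wordGrading_succ, Finset.sum_range_succ, ← ih]
    simp [Grading.letter, Pi.single_apply, eq_comm]

/-- The powers of the imaginary unit: real part. -/
def cosine (j : ZMod 4) : ℤ := if j = 0 then 1 else if j = 2 then -1 else 0

/-- The powers of the imaginary unit: imaginary part. -/
def sine (j : ZMod 4) : ℤ := if j = 1 then 1 else if j = 3 then -1 else 0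

-- Developing the boundary walk into the plane.

namespace Tiling
variable {k : ℕ}

/-- The potential of a corner: `2 z̄ - i ^ j` for the corner `j` of the tile at `z`. -/
def potential (pos : Fin k → ℤ × ℤ) (c : Fin k × ZMod 4) : ℤ × ℤ :=
  (2 * (pos c.1).1 - cosine c.2, -2 * (pos c.1).2 - sine c.2)

/-- The pairing of a vector with `(1 - i) i ^ j`. -/
def pairing (v : ℤ × ℤ) (j : ZMod 4) : ℤ :=
  v.1 * (cosine j + sine j) + v.2 * (sine j - cosine j)

theorem step_snd (T : Tiling k) (c : Fin k × ZMod 4) :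
    (¬ T.IsLast c → (T.step c).2 = c.2 + 1) := by
  intro h
  unfold IsLast at h
  unfold step
  split
  · rfl
  · contradiction

theorem forall_zmod_four {P : ZMod 4 → Prop} (h0 : P 0) (h1 : P 1) (h2 : P 2) (h3 : P 3)
    (j : ZMod 4) : P j := by
  have h : ∀ j : ZMod 4, j = 0 ∨ j = 1 ∨ j = 2 ∨ j = 3 := by decide
  rcases h j with rfl | rfl | rfl | rfl <;> assumption

/-- The potential is chosen so that both kinds of step, into the next tile or along a boundary side,
add the same complex number `(1 + i) i ^ j`, which depends only on the label `j` of the corner being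
left. -/
theorem potential_step (T : Tiling k) (pos : Fin k → ℤ × ℤ)
    (hpos : ∀ t s t', T.nb t s = some t' → pos t' = pos t + shift s) (c : Fin k × ZMod 4) :
    (potential pos (T.step c)).1 = (potential pos c).1 + cosine c.2 - sine c.2 ∧
    (potential pos (T.step c)).2 = (potential pos c).2 + cosine c.2 + sine c.2 := by
  unfold step
  split
  · rename_i t ht
    have h := hpos _ _ _ ht
    obtain ⟨c, j⟩ := c
    simp only [potential, h]
    clear h ht
    revert j
    apply forall_zmod_four <;> simp +decide [cosine, sine, shift] <;> ring
  · obtain ⟨c, j⟩ := c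
    simp only [potential]
    rename_i h
    clear h
    revert j
    apply forall_zmod_four <;> (simp +decide [cosine, sine]; try ring)

theorem walk_potential (T : Tiling k) (pos : Fin k → ℤ × ℤ)
    (hpos : ∀ t s t', T.nb t s = some t' → pos t' = pos t + shift s) (c₀ : Fin k × ZMod 4)
    (f : ℕ → ZMod 4) (hf : ∀ p, (T.step^[p] c₀).2 = f p) (q : ℕ) :
    (potential pos (T.step^[q] c₀)).1 = (potential pos c₀).1 +
        ((wordGrading f q).mult 0 - (wordGrading f q).mult 2) -
        ((wordGrading f q).mult 1 - (wordGrading f q).mult 3) ∧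
      (potential pos (T.step^[q] c₀)).2 = (potential pos c₀).2 +
        ((wordGrading f q).mult 0 - (wordGrading f q).mult 2) +
        ((wordGrading f q).mult 1 - (wordGrading f q).mult 3) := by
  induction q with
  | zero => simp [wordGrading]
  | succ q ih =>
    rw [Function.iterate_succ_apply', (potential_step T pos hpos _).1,
      (potential_step T pos hpos _).2, ih.1, ih.2, wordGrading_succ, hf]
    simp only [Grading.letter, Grading.mul_mult]
    generalize (wordGrading f q).mult = X
    generalize f q = j
    revert j
    apply forall_zmod_four <;> simp +decide [cosine, sine] <;> constructor <;> ring

/-- Appending the letter `j` changes the Maslov component by `-1 + m (j - 1) - m (j + 1)`, where `m`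
are the multiplicities so far. By `walk_potential` the potential has moved by `(1 + i) ∑ m a * i ^
a`, and the real inner product of `(1 + i) i ^ a` with `(1 - i) i ^ j` is `2` for `a = j - 1`, `-2`
for `a = j + 1` and `0` otherwise. The sum of the pairings is hence twice the Maslov component
corrected by the length, up to the contribution of the initial potential, which is subtracted. -/
theorem walk_maslov (T : Tiling k) (pos : Fin k → ℤ × ℤ)
    (hpos : ∀ t s t', T.nb t s = some t' → pos t' = pos t + shift s) (c₀ : Fin k × ZMod 4)
    (f : ℕ → ZMod 4) (hf : ∀ p, (T.step^[p] c₀).2 = f p) (q : ℕ) :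
    2 * ((wordGrading f q).maslov + q) =
      ∑ p ∈ Finset.range q, pairing (potential pos (T.step^[p] c₀)) (T.step^[p] c₀).2 -
      ((potential pos c₀).1 * (((wordGrading f q).mult 0 - (wordGrading f q).mult 2) +
          ((wordGrading f q).mult 1 - (wordGrading f q).mult 3)) +
        (potential pos c₀).2 * (((wordGrading f q).mult 1 - (wordGrading f q).mult 3) -
          ((wordGrading f q).mult 0 - (wordGrading f q).mult 2))) := by
  induction q with
  | zero => simp [wordGrading]
  | succ q ih =>
    have h := walk_potential T pos hpos c₀ f hf q
    rw [Finset.sum_range_succ, wordGrading_succ, Grading.mul_maslov, Grading.mul_mult, pairing,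
      h.1, h.2, hf]
    simp only [Grading.letter, link_single_right]
    generalize ∑ p ∈ Finset.range q, pairing (potential pos (T.step^[p] c₀)) (T.step^[p] c₀).2 = s
      at *
    generalize wordGrading f q = g at *
    generalize potential pos c₀ = v at *
    clear h
    generalize f q = j
    revert j
    apply forall_zmod_four <;> simp +decide [cosine, sine] <;>
      simp only [show (-1 : ZMod 4) = 3 from rfl, show (1 : ZMod 4) + 1 = 2 from rfl,
        show (2 : ZMod 4) - 1 = 1 from rfl, show (2 : ZMod 4) + 1 = 3 from rfl,
        show (3 : ZMod 4) - 1 = 2 from rfl, show (3 : ZMod 4) + 1 = 0 from rfl] <;>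
      linarith

end Tiling

-- The boundary of a disk has central grading.

section Disk
variable {k : ℕ} {T : Tiling k} {c₀ : Fin k × ZMod 4} {word : List Chord} {w : ℕ}

open Classical in
/-- The corners of a disk at interior vertices. -/
def IsDisk.interiorCorners (_ : IsDisk T c₀ word w) : Finset (Fin k × ZMod 4) :=
  Finset.univ.filter fun c => ∀ p < (letters word).length, T.step^[p] c₀ ≠ c

theorem IsDisk.mem_interiorCorners (h : IsDisk T c₀ word w) {c : Fin k × ZMod 4} :
    c ∈ h.interiorCorners ↔ ∀ p < (letters word).length, T.step^[p] c₀ ≠ c := by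
  simp [IsDisk.interiorCorners]

/-- The boundary walk visits no corner twice, and the corners it misses are the interior ones; sums
over the boundary can thus be computed from sums over tiles and over interior vertices. -/
theorem IsDisk.sum_walk_add_sum_interior (h : IsDisk T c₀ word w) (g : Fin k × ZMod 4 → ℤ) :
    ∑ p ∈ Finset.range (letters word).length, g (T.step^[p] c₀) + ∑ c ∈ h.interiorCorners, g c =
      ∑ c, g c := by
  classical
  have h1 : ∑ p ∈ Finset.range (letters word).length, g (T.step^[p] c₀) =
      ∑ c ∈ Finset.univ.filter (fun c => ¬ ∀ p < (letters word).length, T.step^[p] c₀ ≠ c), g c := by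
    rw [← Finset.sum_image (f := g) (g := fun p => T.step^[p] c₀)
      (fun a ha b hb hab => h.once (by simpa using ha) (by simpa using hb) hab)]
    congr 1
    ext c
    simp
  rw [h1, add_comm, IsDisk.interiorCorners, Finset.sum_filter_add_sum_filter_not]

theorem IsDisk.card_interior (h : IsDisk T c₀ word w) : h.interiorCorners.card = 4 * w := by
  have h1 := h.sum_walk_add_sum_interior fun _ => 1
  have h2 := h.interior_count
  simp [ZMod.card] at h1
  omega

/-- If an interior corner stepped onto the boundary walk, three further steps would lead back to it,
by periodicity four, while staying on the closed walk. -/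
theorem IsDisk.step_mem_interior (h : IsDisk T c₀ word w) {c : Fin k × ZMod 4}
    (hc : c ∈ h.interiorCorners) : T.step c ∈ h.interiorCorners := by
  rw [h.mem_interiorCorners] at *
  intro p hp e
  have h4 := (h.interior c hc).1
  have h5 : T.step^[3 + p] c₀ = c := by
    rw [Function.iterate_add_apply, e, ← Function.iterate_succ_apply]
    exact h4
  have hN : 0 < (letters word).length := by omega
  refine hc ((3 + p) % (letters word).length) (Nat.mod_lt _ hN) ?_
  have : T.step^[(letters word).length * ((3 + p) / (letters word).length)] c₀ = c₀ := by
    rw [Function.iterate_mul]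
    exact Function.iterate_fixed h.closed _
  rw [← h5]
  conv_rhs => rw [← Nat.mod_add_div (3 + p) (letters word).length, Function.iterate_add_apply, this]

theorem IsDisk.iterate_mem_interior (h : IsDisk T c₀ word w) {c : Fin k × ZMod 4}
    (hc : c ∈ h.interiorCorners) (r : ℕ) : T.step^[r] c ∈ h.interiorCorners := by
  induction r with
  | zero => exact hc
  | succ r ih => rw [Function.iterate_succ_apply']; exact h.step_mem_interior ih

theorem IsDisk.sum_interior_step (h : IsDisk T c₀ word w) (g : Fin k × ZMod 4 → ℤ) :
    ∑ c ∈ h.interiorCorners, g (T.step c) = ∑ c ∈ h.interiorCorners, g c := by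
  have h4 : ∀ c ∈ h.interiorCorners, T.step^[4] c = c := fun c hc =>
    (h.interior c (h.mem_interiorCorners.1 hc)).1
  refine Finset.sum_nbij' T.step T.step^[3] (fun c hc => h.step_mem_interior hc)
    (fun c hc => h.iterate_mem_interior hc 3) h4 (fun c hc => ?_) fun c hc => rfl
  rw [← Function.iterate_succ_apply' T.step 3 c]
  exact h4 c hc

/-- The step permutes the interior corners and raises their labels by one, so the four labels occur
equally often among `4 * w` corners. -/
theorem IsDisk.count_interior (h : IsDisk T c₀ word w) (j : ZMod 4) :
    ∑ c ∈ h.interiorCorners, (if c.2 = j then 1 else 0 : ℤ) = w := by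
  have key : ∀ j : ZMod 4, ∑ c ∈ h.interiorCorners, (if c.2 = j then 1 else 0 : ℤ) =
      ∑ c ∈ h.interiorCorners, (if c.2 = j + 1 then 1 else 0 : ℤ) := by
    intro j
    rw [← h.sum_interior_step fun c => if c.2 = j + 1 then 1 else 0]
    refine Finset.sum_congr rfl fun c hc => ?_
    rw [T.step_snd c ((h.interior c (h.mem_interiorCorners.1 hc)).2 0 (by norm_num))]
    simp
  have tot : ∑ j : ZMod 4, ∑ c ∈ h.interiorCorners, (if c.2 = j then 1 else 0 : ℤ) = 4 * w := by
    rw [Finset.sum_comm]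
    simp [h.card_interior]
  rw [sum_zmod_four] at tot
  have e0 := key 0
  have e1 := key 1
  have e2 := key 2
  rw [zero_add] at e0
  rw [show (1 : ZMod 4) + 1 = 2 from rfl] at e1
  rw [show (2 : ZMod 4) + 1 = 3 from rfl] at e2
  revert j
  apply Tiling.forall_zmod_four <;> linarith

/-- Around an interior vertex the labels run through all of `ZMod 4`, so the initial potential
cancels and the four pairings add up to `4`. The sum of these orbit sums over all interior corners
counts every pairing four times. -/
theorem IsDisk.sum_interior_pairing (h : IsDisk T c₀ word w) (pos : Fin k → ℤ × ℤ)
    (hpos : ∀ t s t', T.nb t s = some t' → pos t' = pos t + shift s) :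
    ∑ c ∈ h.interiorCorners, Tiling.pairing (Tiling.potential pos c) c.2 = 4 * w := by
  set g : Fin k × ZMod 4 → ℤ := fun c => Tiling.pairing (Tiling.potential pos c) c.2 with hg
  have e1 := h.sum_interior_step g
  have e2 := h.sum_interior_step fun c => g (T.step c)
  have e3 := h.sum_interior_step fun c => g (T.step (T.step c))
  have e : ∑ c ∈ h.interiorCorners,
      (g c + g (T.step c) + g (T.step (T.step c)) + g (T.step (T.step (T.step c)))) =
      ∑ c ∈ h.interiorCorners, 4 := by
    refine Finset.sum_congr rfl fun c hc => ?_
    have hl := (h.interior c (h.mem_interiorCorners.1 hc)).2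
    have s1 := T.step_snd _ (hl 0 (by norm_num))
    have s2 := T.step_snd _ (hl 1 (by norm_num))
    have s3 := T.step_snd _ (hl 2 (by norm_num))
    have p1 := T.potential_step pos hpos c
    have p2 := T.potential_step pos hpos (T.step c)
    have p3 := T.potential_step pos hpos (T.step (T.step c))
    simp only [Function.iterate_zero, id, Function.iterate_succ, Function.comp] at s1 s2 s3
    simp only [hg, Tiling.pairing, p1.1, p1.2, p2.1, p2.2, p3.1, p3.2, s1, s2, s3]
    clear s1 s2 s3 p1 p2 p3 hl
    obtain ⟨t, j⟩ := c
    simp only [Tiling.potential]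
    clear hc
    revert j
    apply Tiling.forall_zmod_four <;> simp +decide [cosine, sine] <;> ring
  simp only [Finset.sum_add_distrib, Finset.sum_const, h.card_interior] at e
  simp only [nsmul_eq_mul] at e
  push_cast at e
  linarith

theorem IsDisk.grading (h : IsDisk T c₀ word w) :
    (word.map Chord.grading).prod = Grading.central k w := by
  obtain ⟨pos, hpos⟩ := T.develops
  set f : ℕ → ZMod 4 := fun p => (T.step^[p] c₀).2 with hf
  set N := (letters word).length with hN
  have hw : (word.map Chord.grading).prod = wordGrading f N := by
    rw [← prod_letters, wordGrading]
    congr 1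
    apply List.ext_getElem
    · simp [hN]
    · intro p hp _
      have := (h.reads p (by simpa using hp)).1
      simp [hf, this]
  -- Every label occurs once in each tile, and `w` times at interior vertices.
  have hmult : ∀ j, (wordGrading f N).mult j = k - w := by
    intro j
    have h1 := h.sum_walk_add_sum_interior fun c => if c.2 = j then 1 else 0
    rw [h.count_interior j] at h1
    have h2 : ∑ c : Fin k × ZMod 4, (if c.2 = j then 1 else 0 : ℤ) = k := by
      rw [Fintype.sum_prod_type]
      simp
    rw [wordGrading_mult]
    linarith
  -- As the multiplicities are all equal, the terms with the initial potential drop out.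
  have hm := Tiling.walk_maslov T pos hpos c₀ f (fun _ => rfl) N
  simp only [hmult] at hm
  have h1 := h.sum_walk_add_sum_interior fun c => Tiling.pairing (Tiling.potential pos c) c.2
  rw [h.sum_interior_pairing pos hpos] at h1
  have h2 : ∑ c : Fin k × ZMod 4, Tiling.pairing (Tiling.potential pos c) c.2 = -4 * k := by
    rw [Fintype.sum_prod_type]
    -- The position of the tile pairs with `(1 - i) ∑ i ^ j = 0`; only the terms `-i ^ j` of the
    -- potential remain, each contributing `-1`.
    have : ∀ t : Fin k, ∑ j, Tiling.pairing (Tiling.potential pos (t, j)) j = -4 := by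
      intro t
      rw [sum_zmod_four]
      simp +decide [Tiling.pairing, Tiling.potential, cosine, sine]
      ring
    simp [this]
    ring
  have h3 : (N : ℤ) + 4 * w = 4 * k := by exact_mod_cast h.interior_count
  rw [hw]
  ext j
  · simp only [Grading.central]
    linarith
  · rw [hmult j]; rfl

end Disk

-- Gradings of chords and paths.

theorem Chord.grading_concat (i : ZMod 4) (l m : ℕ) :
    Chord.grading (i, l + m + 1) = Chord.grading (i, l) * Chord.grading (i + l + 1, m) := by
  unfold Chord.grading
  simp only
  rw [show l + m + 1 + 1 = (l + 1) + (m + 1) by ring, List.range_add, List.map_append,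
    List.prod_append, List.map_map]
  congr 3
  funext p
  simp only [Function.comp]
  push_cast
  ring_nf

/-- The grading of a basis element. -/
def Path.grading : Path → Grading
  | .idem _ => 1
  | .chord i l => Chord.grading (i, l)

theorem Path.grading_mul {x y z : Path} (h : x.mul y = some z) :
    x.grading * y.grading = z.grading := by
  cases x with
  | idem i =>
    simp only [Path.mul] at h
    split_ifs at h
    cases h
    exact one_mul _
  | chord i l =>
    cases y with
    | idem j =>
      simp only [Path.mul] at h
      split_ifs at h
      cases h
      exact mul_one _
    | chord j m =>
      simp only [Path.mul] at h
      split_ifs at h with hj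
      cases h
      subst hj
      exact (Chord.grading_concat i l m).symm

theorem Chord.grading_zero (i : ZMod 4) : Chord.grading (i, 0) = Grading.letter i := by
  simp [Chord.grading]

theorem Chord.grading_succ (i : ZMod 4) (l : ℕ) :
    Chord.grading (i, l + 1) = Chord.grading (i, l) * Grading.letter (i + l + 1) := by
  rw [← Chord.grading_zero]
  exact Chord.grading_concat i l 0

theorem Chord.grading_one (i : ZMod 4) :
    Chord.grading (i, 1) = ⟨-1, Pi.single i 1 + Pi.single (i + 1) 1⟩ := by
  have h : ∀ i : ZMod 4, i + 1 ≠ i ∧ i + 1 + 1 ≠ i := by decide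
  rw [Chord.grading_succ, Chord.grading_zero]
  ext j
  · simp [Grading.letter, link_single_right, h i]
  · simp [Grading.letter]

theorem Chord.grading_two (i : ZMod 4) :
    Chord.grading (i, 2) = ⟨-1, Pi.single i 1 + Pi.single (i + 1) 1 + Pi.single (i + 2) 1⟩ := by
  rw [Chord.grading_succ, Chord.grading_one]
  revert i
  apply Tiling.forall_zmod_four <;>
    refine Grading.ext ?_ (funext (Tiling.forall_zmod_four ?_ ?_ ?_ ?_)) <;>
      decide

/-- A full turn is central and inverse to `central 0 1`. This is the homogeneity of the curvature,
and it reduces all chord gradings to lengths at most four. -/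
theorem Chord.grading_three (i : ZMod 4) : Chord.grading (i, 3) = Grading.central 0 (-1) := by
  rw [Chord.grading_succ, Chord.grading_two]
  revert i
  apply Tiling.forall_zmod_four <;>
    refine Grading.ext ?_ (funext (Tiling.forall_zmod_four ?_ ?_ ?_ ?_)) <;>
      decide

theorem Chord.grading_add_four (i : ZMod 4) (l : ℕ) :
    Chord.grading (i, l + 4) = Grading.central 0 (-1) * Chord.grading (i, l) := by
  rw [show l + 4 = l + 3 + 1 by ring, Chord.grading_concat, Chord.grading_three,
    Grading.central_comm]

/-- The grading of a path consists of full turns and of a remainder which misses a short chord. -/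
theorem Path.exists_grading (b : Path) : ∃ (a : ℕ) (s : ZMod 4 → ℤ), (∀ j, 0 ≤ s j) ∧
    (∃ j, s j = 0) ∧ (∀ j, b.grading.mult j = a + s j) ∧
    ((∀ j, s j = 0) ∧ b.grading.maslov = -2 * a ∨
      (∃ j, s j ≠ 0) ∧ b.grading.maslov = -2 * a - 1) := by
  cases b with
  | idem i => exact ⟨0, 0, by simp, by simp, by simp [Path.grading], Or.inl (by simp [Path.grading])⟩
  | chord i l =>
    simp only [Path.grading]
    induction l using Nat.strong_induction_on with
    | _ l ih =>
      match l, ih with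
      | 0, _ =>
        rw [Chord.grading_zero]
        refine ⟨0, Pi.single i 1, ?_, ⟨i + 1, ?_⟩, by simp [Grading.letter], Or.inr
          ⟨⟨i, by simp⟩, by simp [Grading.letter]⟩⟩ <;>
          clear * - <;> decide +revert
      | 1, _ =>
        rw [Chord.grading_one]
        refine ⟨0, Pi.single i 1 + Pi.single (i + 1) 1, ?_, ⟨i + 2, ?_⟩, by simp,
          Or.inr ⟨⟨i, ?_⟩, by simp⟩⟩ <;>
          clear * - <;> decide +revert
      | 2, _ =>
        rw [Chord.grading_two]
        refine ⟨0, Pi.single i 1 + Pi.single (i + 1) 1 + Pi.single (i + 2) 1, ?_, ⟨i + 3, ?_⟩,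
          by simp, Or.inr ⟨⟨i, ?_⟩, by simp⟩⟩ <;>
          clear * - <;> decide +revert
      | 3, _ =>
        rw [Chord.grading_three]
        exact ⟨1, 0, by simp, by simp, by simp [Grading.central],
          Or.inl (by simp [Grading.central])⟩
      | l + 4, ih =>
        obtain ⟨a, s, h0, h1, h2, h3⟩ := ih l (by omega)
        rw [Chord.grading_add_four]
        refine ⟨a + 1, s, h0, h1, fun j => ?_, ?_⟩
        · simp [Grading.central, h2]; ring
        · simp only [Grading.mul_maslov, Grading.central, link_const_left]
          push_cast
          rcases h3 with h3 | h3
          · exact Or.inl ⟨h3.1, by rw [h3.2]; ring⟩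
          · exact Or.inr ⟨h3.1, by rw [h3.2]; ring⟩

-- Homogeneity of the operations and of their compositions.

theorem exists_disk_of_diskCount_ne_zero {word : List Chord} {w : ℕ} (h : diskCount word w ≠ 0) :
    ∃ k, tileCount word.length w = k ∧ word.length + 2 * w = 2 * k + 2 ∧
      (word.map Chord.grading).prod = Grading.central k w := by
  unfold diskCount at h
  have := (Nat.card_ne_zero.1 h).1
  obtain ⟨q⟩ := this
  obtain ⟨D, -⟩ := Quot.exists_rep q
  exact ⟨_, rfl, D.2.euler, D.2.grading⟩

section
variable {R : Type} [CommRing R]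

theorem diskCount_ne_zero_of_mul {n : ℕ} {r : R} (h : (n : R) * r ≠ 0) : n ≠ 0 := by
  rintro rfl
  simp at h

/-- For the centered operation this is the grading of a disk. An extension multiplies both sides by
the grading of `ρ`, on the left or on the right; for the latter, centrality brings the correction to
the other side. -/
theorem diskOp_grading {u : R} {w : ℕ} {word : List Chord} {b : Path}
    (h : b ∈ (diskOp u w word).support) :
    ∃ k : ℕ, word.length + 2 * w = 2 * k + 2 ∧
      (word.map Chord.grading).prod = b.grading * Grading.central k w := by
  classical
  match word, h with
  | [], h => simp [diskOp] at h
  | (i, l) :: rest, h =>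
    simp only [diskOp] at h
    rcases Finset.mem_union.1 (Finsupp.support_add h) with h | h
    · rcases Finset.mem_union.1 (Finsupp.support_add h) with h | h
      · obtain ⟨rfl, h0⟩ := (Finsupp.mem_support_single _ _ _).1 h
        obtain ⟨k, -, hk, hg⟩ := exists_disk_of_diskCount_ne_zero (diskCount_ne_zero_of_mul h0)
        exact ⟨k, hk, by rw [hg]; simp [Path.grading]⟩
      · obtain ⟨m, hm, h⟩ := Finset.mem_biUnion.1 (Finsupp.support_finsetSum h)
        obtain ⟨rfl, h0⟩ := (Finsupp.mem_support_single _ _ _).1 h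
        obtain ⟨k, -, hk, hg⟩ := exists_disk_of_diskCount_ne_zero (diskCount_ne_zero_of_mul h0)
        refine ⟨k, by simpa using hk, ?_⟩
        have hl : l = m + (l - (m + 1)) + 1 := by have := Finset.mem_range.1 hm; omega
        rw [← hg]
        conv_lhs => rw [hl]
        simp only [List.map_cons, List.prod_cons, Path.grading, Chord.grading_concat, mul_assoc]
    · obtain ⟨m, hm, h⟩ := Finset.mem_biUnion.1 (Finsupp.support_finsetSum h)
      have hne : (i, l) :: rest ≠ [] := List.cons_ne_nil _ _
      have hv := List.dropLast_append_getLast hne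
      obtain ⟨e, h0⟩ := (Finsupp.mem_support_single _ _ _).1 h
      obtain ⟨k, -, hk, hg⟩ := exists_disk_of_diskCount_ne_zero (diskCount_ne_zero_of_mul h0)
      rw [e]
      generalize ((i, l) :: rest).getLast _ = z at hk hg hm hv ⊢
      generalize ((i, l) :: rest).dropLast = init at hk hg hv
      refine ⟨k, by rw [← hv]; simpa using hk, ?_⟩
      obtain ⟨j, p⟩ := z
      have hl : p = m + (p - (m + 1)) + 1 := by have := Finset.mem_range.1 hm; simp at this; omega
      rw [← Grading.central_comm, ← hg, ← hv]
      conv_lhs => rw [hl]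
      simp [Path.grading, Chord.grading_concat, mul_assoc]

theorem mapM_toChord {bs : List Path} {word : List Chord} (h : bs.mapM Path.toChord = some word) :
    bs.length = word.length ∧ bs.map Path.grading = word.map Chord.grading := by
  induction bs generalizing word with
  | nil => simp at h; subst h; simp
  | cons b bs ih =>
    rw [List.mapM_cons] at h
    cases b with
    | idem i => simp [Path.toChord] at h
    | chord i l =>
      cases h' : bs.mapM Path.toChord with
      | none => simp [Path.toChord, h'] at h
      | some v =>
        simp [Path.toChord, h'] at h
        subst h
        have := ih h'
        simp [this.1, this.2, Path.grading]

theorem basisOp_grading {u : R} {w : ℕ} {bs : List Path} {b : Path}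
    (h : b ∈ (basisOp u w bs).support) :
    ∃ k : ℕ, bs.length + 2 * w = 2 * k + 2 ∧
      (bs.map Path.grading).prod = b.grading * Grading.central k w := by
  classical
  unfold basisOp at h
  split at h
  · rename_i x y
    cases hxy : x.mul y with
    | none => simp [hxy] at h
    | some z =>
      simp only [hxy] at h
      obtain ⟨rfl, -⟩ := (Finsupp.mem_support_single _ _ _).1 h
      exact ⟨0, rfl, by simp [Path.grading_mul hxy]⟩
  · obtain ⟨i, -, h⟩ := Finset.mem_biUnion.1 (Finsupp.support_finsetSum h)
    obtain ⟨rfl, -⟩ := (Finsupp.mem_support_single _ _ _).1 h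
    refine ⟨0, rfl, ?_⟩
    simp [Path.grading, Chord.grading_three, Grading.central_add]
  · split at h
    · rename_i word hw
      obtain ⟨h1, h2⟩ := mapM_toChord hw
      rw [h1, h2]
      exact diskOp_grading h
    · simp at h

theorem mem_support_extend {f : List Path → Alg R} {as : List (Alg R)} {b : Path}
    (h : b ∈ (extend f as).support) :
    ∃ bs, List.Forall₂ (fun (p : Path) (a : Alg R) => p ∈ a.support) bs as ∧
      b ∈ (f bs).support := by
  classical
  induction as generalizing f with
  | nil => exact ⟨[], .nil, h⟩
  | cons a as ih =>
    obtain ⟨p, hp, h⟩ := Finset.mem_biUnion.1 (Finsupp.support_sum h)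
    obtain ⟨bs, h1, h2⟩ := ih (Finsupp.support_smul h)
    exact ⟨p :: bs, .cons hp h1, h2⟩

theorem mu_grading {u : R} {w : ℕ} {as : List (Alg R)} {b : Path} (h : b ∈ (mu u w as).support) :
    ∃ bs, List.Forall₂ (fun (p : Path) (a : Alg R) => p ∈ a.support) bs as ∧
      ∃ k : ℕ, as.length + 2 * w = 2 * k + 2 ∧
      (bs.map Path.grading).prod = b.grading * Grading.central k w := by
  obtain ⟨bs, h1, h2⟩ := mem_support_extend h
  obtain ⟨k, h3, h4⟩ := basisOp_grading h2
  exact ⟨bs, h1, k, by rw [← h1.length_eq]; exact h3, h4⟩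

theorem forestEval_length (u : R) (ts : List WTree) (as : List (Alg R)) :
    (forestEval u ts as).length = ts.length := by
  induction ts generalizing as with
  | nil => rfl
  | cons t ts ih => simp [forestEval, ih]

mutual
-- A vertex with `m` inputs and weight `w` contributes `k` with `2 * k = m + 2 * w - 2`, and these
-- numbers add up to the dimension of the tree. Since the corrections are central and additive, they
-- can be collected at the end.
theorem WTree.eval_grading {u : R} (T : WTree) (as : List (Alg R)) (hl : as.length = T.inputs)
    (b : Path) (hb : b ∈ (T.eval u as).support) :
    ∃ bs, List.Forall₂ (fun (p : Path) (a : Alg R) => p ∈ a.support) bs as ∧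
      ∃ K : ℕ, (2 * K : ℤ) = (GTree.tree T).dim ∧
      (bs.map Path.grading).prod = b.grading * Grading.central K T.weight :=
  match T, hl, hb with
  | .input, hl, hb => by
    obtain ⟨a, rfl⟩ := List.length_eq_one_iff.1 hl
    refine ⟨[b], .cons hb .nil, 0, by simp [GTree.dim, WTree.inputs, WTree.weight, WTree.vertices],
      by simp [WTree.weight]⟩
  | .node w ts, hl, hb => by
    rw [WTree.eval] at hb
    obtain ⟨bs', h1, k, h2, h3⟩ := mu_grading hb
    obtain ⟨bs, h4, K, h5, h6⟩ := forestEval_grading ts as hl bs' h1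
    rw [forestEval_length] at h2
    refine ⟨bs, h4, k + K, ?_, ?_⟩
    · simp only [GTree.dim, WTree.inputs, WTree.weight, WTree.vertices]
      push_cast
      omega
    · rw [h6, h3, mul_assoc, Grading.central_add, WTree.weight]
      push_cast
      rfl
theorem forestEval_grading {u : R} (ts : List WTree) (as : List (Alg R))
    (hl : as.length = forestInputs ts) (bs' : List Path)
    (hb : List.Forall₂ (fun (p : Path) (a : Alg R) => p ∈ a.support) bs' (forestEval u ts as)) :
    ∃ bs, List.Forall₂ (fun (p : Path) (a : Alg R) => p ∈ a.support) bs as ∧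
      ∃ K : ℕ, (2 * K : ℤ) =
        forestInputs ts + 2 * forestWeight ts - forestVertices ts - ts.length ∧
      (bs.map Path.grading).prod =
        (bs'.map Path.grading).prod * Grading.central K (forestWeight ts) :=
  match ts, hl, hb with
  | [], hl, hb => by
    have : as = [] := List.length_eq_zero_iff.1 hl
    subst this
    cases hb
    exact ⟨[], .nil, 0, by simp [forestInputs, forestWeight, forestVertices],
      by simp [forestWeight]⟩
  | t :: ts, hl, hb => by
    rw [forestEval] at hb
    rw [forestInputs] at hl
    obtain ⟨b, bs', rfl, hb1, hb2⟩ : ∃ b cs, bs' = b :: cs ∧ b ∈ (t.eval u (as.take t.inputs)).support ∧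
        List.Forall₂ (fun (p : Path) (a : Alg R) => p ∈ a.support) cs
          (forestEval u ts (as.drop t.inputs)) := by
      cases hb with
      | cons h1 h2 => exact ⟨_, _, rfl, h1, h2⟩
    obtain ⟨bs1, h1, K1, h2, h3⟩ :=
      WTree.eval_grading t (as.take t.inputs) (by simp [hl]) b hb1
    obtain ⟨bs2, h4, K2, h5, h6⟩ :=
      forestEval_grading ts (as.drop t.inputs) (by simp [hl]) bs' hb2
    refine ⟨bs1 ++ bs2, ?_, K1 + K2, ?_, ?_⟩
    · have := List.rel_append h1 h4
      simp only [List.take_append_drop] at this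
      exact this
    · simp only [GTree.dim] at h2
      simp only [forestInputs, forestWeight, forestVertices, List.length_cons]
      push_cast
      omega
    · rw [List.map_append, List.prod_append, h3, h6, List.map_cons, List.prod_cons, forestWeight]
      push_cast
      rw [← Grading.central_add, mul_assoc, mul_assoc, ← mul_assoc (Grading.central K1 _),
        Grading.central_comm, mul_assoc]
end

theorem GTree.eval_grading {u : R} (T : GTree) (as : List (Alg R)) (hl : as.length = T.inputs)
    (b : Path) (hb : b ∈ (T.eval u as).support) :
    ∃ bs, List.Forall₂ (fun (p : Path) (a : Alg R) => p ∈ a.support) bs as ∧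
      ∃ K : ℕ, (2 * K : ℤ) = T.dim ∧
      (bs.map Path.grading).prod = b.grading * Grading.central K T.weight := by
  classical
  cases T with
  | tree t => exact WTree.eval_grading t as hl b hb
  | stump =>
    have : as = [] := List.length_eq_zero_iff.1 hl
    subst this
    refine ⟨[], .nil, 0, by simp [GTree.dim], ?_⟩
    rcases Finset.mem_union.1 (Finsupp.support_add hb) with h | h <;>
      obtain ⟨rfl, -⟩ := (Finsupp.mem_support_single _ _ _).1 h <;>
      simp [Path.grading, GTree.weight]

end

-- Gradings of the structure map and the numerical constraint.

/-- The pairs of chords in the structure map of the dualizing bimodule. -/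
def dualPairs : List (Chord × Chord) :=
  [((1, 0), (3, 0)), ((3, 0), (1, 0)), ((1, 2), (1, 2)), ((3, 2), (3, 2)),
    ((2, 0), (2, 0)), ((4, 0), (4, 0)), ((2, 2), (4, 2)), ((4, 2), (2, 2))]

/-- The reflection reverses the cyclic order and so exchanges the two halves of the skew form. -/
theorem link_comp_neg (x y : ZMod 4 → ℤ) :
    link (fun j => x (-j)) (fun j => y (-j)) = -link x y := by
  rw [link, link, ← Equiv.sum_comp (Equiv.neg (ZMod 4)), ← Finset.sum_neg_distrib]
  refine Finset.sum_congr rfl fun i _ => ?_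
  simp only [Equiv.neg_apply, neg_neg]
  rw [show -(-i + 1) = i - 1 by ring, show -(-i - 1) = i + 1 by ring]
  ring

theorem dualPairs_grading : ∀ c ∈ dualPairs, (∀ j, c.2.grading.mult j = c.1.grading.mult (-j)) ∧
    c.1.grading.maslov + c.2.grading.maslov = -2 ∧
    ∑ j, c.1.grading.mult j = 1 + c.1.2 := by
  intro c hc
  simp only [dualPairs, List.mem_cons, List.not_mem_nil, or_false] at hc
  rcases hc with rfl | rfl | rfl | rfl | rfl | rfl | rfl | rfl <;>
    simp only [Chord.grading_zero, Chord.grading_two, Grading.letter] <;>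
    refine ⟨?_, ?_, ?_⟩ <;> decide

theorem dualPairs_length_even : ∀ c ∈ dualPairs, c.1.2 = 0 ∧ c.2.2 = 0 ∨ c.1.2 = 2 ∧ c.2.2 = 2 := by
  decide

/-- The gradings of a sequence of terms of the structure map: the reflection which exchanges
`ρ₁` and `ρ₃` reverses the sign of the linking, so that the Maslov components add up. -/
theorem prod_dualPairs_grading (cs : List (Chord × Chord)) (h : ∀ c ∈ cs, c ∈ dualPairs) :
    let g : Grading := (cs.map fun c => c.1.grading).prod
    let g' : Grading := (cs.map fun c => c.2.grading).prod
    (∀ j, g'.mult j = g.mult (-j)) ∧ g.maslov + g'.maslov = -2 * (cs.length : ℤ) ∧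
      ∑ j, g.mult j = (cs.length : ℤ) + ((cs.map fun c => c.1.2).sum : ℕ) := by
  induction cs with
  | nil => simp
  | cons c cs ih =>
    have h1 := dualPairs_grading c (h c (by simp))
    have h2 := ih fun c hc => h c (by simp [hc])
    simp only [List.map_cons, List.prod_cons, List.sum_cons, Grading.mul_maslov, Grading.mul_mult,
      Pi.add_apply, List.length_cons, Finset.sum_add_distrib] at h2 ⊢
    refine ⟨fun j => by rw [h1.1, h2.1], ?_, ?_⟩
    · rw [funext h1.1, funext h2.1, link_comp_neg]
      push_cast
      linarith
    · simp only [Nat.cast_add, Nat.cast_one]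
      linarith

theorem sum_length_even (cs : List (Chord × Chord)) (h : ∀ c ∈ cs, c ∈ dualPairs) :
    Even (cs.map fun c => c.1.2).sum := by
  induction cs with
  | nil => simp
  | cons c cs ih =>
    have h2 := ih fun c hc => h c (by simp [hc])
    rw [List.map_cons, List.sum_cons]
    rcases dualPairs_length_even c (h c (by simp)) with h1 | h1 <;> rw [h1.1]
    · simpa using h2
    · exact even_two.add h2

/-- The gradings in a nonvanishing term of the structure equation. -/
theorem grading_constraints {n w w₁ w₂ K₁ K₂ m : ℕ} {g g' : Grading} {b b' : Path}
    (h : ∀ j, g'.mult j = g.mult (-j)) (hm : g.maslov + g'.maslov = -2 * n)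
    (hs : ∑ j, g.mult j = n + m) (hb : g = b.grading * Grading.central K₁ w₁)
    (hb' : g' = b'.grading * Grading.central K₂ w₂) (hK : 2 * K₁ + 2 * K₂ + 2 = n + 2 * w)
    (_ : w₁ ≤ w) (_ : w₂ ≤ w) :
    w ≤ 1 ∧ n + m + 4 * w = 4 := by
  obtain ⟨a, s, s0, ⟨j, hj⟩, hmult, hcase⟩ := b.exists_grading
  obtain ⟨a', s', s0', ⟨j', hj'⟩, hmult', hcase'⟩ := b'.exists_grading
  have e1 : ∀ j, g.mult j = a + s j + (K₁ - w₁) := fun j => by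
    rw [hb, Grading.mul_mult, Pi.add_apply, hmult]; rfl
  have e2 : ∀ j, g'.mult j = a' + s' j + (K₂ - w₂) := fun j => by
    rw [hb', Grading.mul_mult, Pi.add_apply, hmult']; rfl
  have e3 : ∀ j, a' + s' j + (K₂ - w₂ : ℤ) = a + s (-j) + (K₁ - w₁) := fun j => by
    rw [← e1, ← e2, h]
  have m1 : g.maslov = b.grading.maslov + (-6 * K₁ + 2 * w₁) := by
    rw [hb, Grading.mul_maslov]
    simp [Grading.central, link_const_right]
  have m2 : g'.maslov = b'.grading.maslov + (-6 * K₂ + 2 * w₂) := by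
    rw [hb', Grading.mul_maslov]
    simp [Grading.central, link_const_right]
  -- Comparison at a short chord missed by the remainder of one output, and then of the other, shows
  -- that the minimal multiplicities agree; the remainders are therefore reflections of each other.
  have c1 := e3 (-j)
  rw [neg_neg, hj] at c1
  have c2 := e3 j'
  rw [hj'] at c2
  have p1 := s0' (-j)
  have p2 := s0 (-j')
  have hc : (a' + (K₂ - w₂) : ℤ) = a + (K₁ - w₁) := by linarith
  have hss : ∀ j, s' j = s (-j) := fun j => by linarith [e3 j]
  rw [m1, m2] at hm
  have hsum : ∑ j, g.mult j = 4 * (a + (K₁ - w₁)) + ∑ j, s j := by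
    simp only [e1, sum_zmod_four]
    ring
  rcases hcase with ⟨z, hcase⟩ | ⟨⟨i, z⟩, hcase⟩ <;>
    rcases hcase' with ⟨z', hcase'⟩ | ⟨⟨i', z'⟩, hcase'⟩
  -- Both outputs consist of full turns: the Maslov and multiplicity equations combine to `n + m + 4
  -- * w = 4`.
  · simp only [z, Finset.sum_const_zero] at hsum
    omega
  · exact absurd (by rw [hss, z]) z'
  · exact absurd (by have := hss (-i); rw [neg_neg, z'] at this; exact this.symm) z
  -- Both remainders are nonzero: the Maslov equation makes `a + a' + K₁ + K₂ + w₁ + w₂` odd, while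
  -- `hc` makes it even.
  · omega

section
variable {R : Type} [CommRing R]

theorem mu_eq_zero_of_mem {u : R} {w : ℕ} {as : List (Alg R)} (h : (0 : Alg R) ∈ as) :
    mu u w as = 0 := by
  unfold mu
  generalize basisOp u w = f
  induction as generalizing f with
  | nil => simp at h
  | cons a as ih =>
    rcases List.mem_cons.1 h with rfl | h
    · simp [extend]
    · simp [extend, ih h]

theorem exists_mem_support {a : Alg R} {r : R} (h : r • a ≠ 0) : ∃ b, b ∈ a.support := by
  by_contra hb
  push Not at hb
  exact h (by rw [Finsupp.support_eq_empty.1 (Finset.eq_empty_of_forall_notMem hb), smul_zero])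

theorem eq_of_forall₂_rho {cs : List Chord} {bs : List Path}
    (h : List.Forall₂ (fun (p : Path) (a : Alg R) => p ∈ a.support) bs
      (cs.map fun c => rho R c.1 c.2)) :
    bs.map Path.grading = cs.map Chord.grading := by
  classical
  induction cs generalizing bs with
  | nil => cases h; rfl
  | cons c cs ih =>
    cases h with
    | cons h1 h2 =>
      obtain ⟨rfl, -⟩ := (Finsupp.mem_support_single _ _ _).1 h1
      simp [ih h2, Path.grading]

end

/-- A pair of chords as a pair of elements of two torus algebras. -/
def chordPair (R₁ R₂ : Type) [CommRing R₁] [CommRing R₂] (c : Chord × Chord) : Alg R₁ × Alg R₂ :=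
  (rho R₁ c.1.1 c.1.2, rho R₂ c.2.1 c.2.2)

theorem mem_iter {R₁ R₂ : Type} [CommRing R₁] [CommRing R₂] {n : ℕ} {x : Fin 2}
    {q : List (Alg R₁ × Alg R₂) × Fin 2}
    (hq : q ∈ (dualizingBimodule R₁ R₂).iter n x) :
    ∃ cs : List (Chord × Chord), (∀ c ∈ cs, c ∈ dualPairs) ∧ cs.length = n ∧
      q.1 = cs.map (chordPair R₁ R₂) := by
  induction n generalizing x q with
  | zero =>
    simp only [DDData.iter, List.mem_singleton] at hq
    subst hq
    exact ⟨[], by simp⟩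
  | succ n ih =>
    simp only [DDData.iter, List.mem_flatMap, List.mem_map] at hq
    obtain ⟨p, hp, r, hr, rfl⟩ := hq
    obtain ⟨cs, h1, h2, h3⟩ := ih hr
    have : ∃ c ∈ dualPairs, (p.1, p.2.1) = chordPair R₁ R₂ c := by
      simp only [dualizingBimodule] at hp
      split_ifs at hp <;> simp only [List.mem_cons, List.not_mem_nil, or_false] at hp <;>
        rcases hp with rfl | rfl | rfl | rfl
      · exact ⟨((1, 0), (3, 0)), by decide, rfl⟩
      · exact ⟨((3, 0), (1, 0)), by decide, rfl⟩
      · exact ⟨((1, 2), (1, 2)), by decide, rfl⟩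
      · exact ⟨((3, 2), (3, 2)), by decide, rfl⟩
      · exact ⟨((2, 0), (2, 0)), by decide, rfl⟩
      · exact ⟨((4, 0), (4, 0)), by decide, rfl⟩
      · exact ⟨((2, 2), (4, 2)), by decide, rfl⟩
      · exact ⟨((4, 2), (2, 2)), by decide, rfl⟩
    obtain ⟨c, hc, hpc⟩ := this
    exact ⟨c :: cs, by simpa [hc] using h1, by simp [h2], by simp [h3, hpc]⟩

section
variable {R₁ R₂ : Type} [CommRing R₁] [CommRing R₂] [Algebra (ZMod 2) R₁] [Algebra (ZMod 2) R₂]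

theorem tensorAt_ne_zero {u₁ : R₁} {u₂ : R₂} {e : Fin 2 × Fin 2} {c : Alg R₁} {d : Alg R₂}
    (h : tensorAt u₁ u₂ e c d ≠ 0) : c ≠ 0 ∧ d ≠ 0 := by
  constructor
  · rintro rfl
    exact h (by rw [tensorAt, mu_eq_zero_of_mem (by simp), TensorProduct.zero_tmul])
  · rintro rfl
    exact h (by rw [tensorAt, mu_eq_zero_of_mem (as := [0, _]) (by simp), TensorProduct.tmul_zero])

theorem pairOp_constraints (Γ : WeightedAlgebraDiagonal) {u₁ : R₁} {u₂ : R₂} {n w : ℕ}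
    {p : GTree × GTree} (hp : p ∈ (Γ.cell n w).support) {cs : List (Chord × Chord)}
    (hcs : ∀ c ∈ cs, c ∈ dualPairs) (hn : cs.length = n) {e : Fin 2 × Fin 2}
    (h : pairOp u₁ u₂ w p (cs.map (chordPair R₁ R₂)) e ≠ 0) :
    w ≤ 1 ∧ n + (cs.map fun c => c.1.2).sum + 4 * w = 4 ∧
      ∃ K₁ K₂ : ℕ, (2 * K₁ : ℤ) = p.1.dim ∧ (2 * K₂ : ℤ) = p.2.dim ∧
        2 * K₁ + 2 * K₂ + 2 = n + 2 * w := by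
  obtain ⟨⟨-, hi1, hw1⟩, ⟨-, hi2, hw2⟩, hd⟩ := Γ.mem n w p hp
  obtain ⟨h1, h2⟩ := tensorAt_ne_zero h
  obtain ⟨b, hb⟩ := exists_mem_support h1
  obtain ⟨b', hb'⟩ := exists_mem_support h2
  obtain ⟨bs, hbs, K₁, hK1, hg1⟩ := GTree.eval_grading p.1 _ (by simp [hn, hi1]) b hb
  obtain ⟨bs', hbs', K₂, hK2, hg2⟩ := GTree.eval_grading p.2 _ (by simp [hn, hi2]) b' hb'
  have e1 := eq_of_forall₂_rho (cs := cs.map Prod.fst)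
    (by simpa [chordPair, Function.comp_def] using hbs)
  have e2 := eq_of_forall₂_rho (cs := cs.map Prod.snd)
    (by simpa [chordPair, Function.comp_def] using hbs')
  rw [e1, List.map_map] at hg1
  rw [e2, List.map_map] at hg2
  obtain ⟨c1, c2, c3⟩ := prod_dualPairs_grading cs hcs
  have hK : 2 * K₁ + 2 * K₂ + 2 = n + 2 * w := by omega
  obtain ⟨r1, r2⟩ := grading_constraints (n := n) (w := w) (w₁ := p.1.weight) (w₂ := p.2.weight)
    (K₁ := K₁) (K₂ := K₂) (m := (cs.map fun c => c.1.2).sum) c1 (by rw [c2, hn])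
    (by rw [c3, hn]) hg1 hg2 hK hw1 hw2
  exact ⟨r1, r2, K₁, K₂, hK1, hK2, hK⟩

/-- Only the operations `μ₀¹`, `μ₂⁰` and `μ₄⁰` contribute to the structure equation. -/
theorem pairOp_cases (Γ : WeightedAlgebraDiagonal) {u₁ : R₁} {u₂ : R₂} {n w : ℕ}
    {p : GTree × GTree} (hp : p ∈ (Γ.cell n w).support) {cs : List (Chord × Chord)}
    (hcs : ∀ c ∈ cs, c ∈ dualPairs) (hn : cs.length = n) {e : Fin 2 × Fin 2}
    (h : pairOp u₁ u₂ w p (cs.map (chordPair R₁ R₂)) e ≠ 0) :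
    (n, w) ∈ ({(0, 1), (2, 0), (4, 0)} : Finset (ℕ × ℕ)) := by
  obtain ⟨h1, h2, K₁, K₂, -, -, h3⟩ := pairOp_constraints Γ hp hcs hn h
  have h4 := sum_length_even cs hcs
  simp only [Finset.mem_insert, Finset.mem_singleton, Prod.mk.injEq]
  obtain ⟨r, hr⟩ := h4
  omega

end

-- Stable trees of weight zero with few inputs.

mutual
-- In weight zero, stability forces at least two subtrees at every vertex, so there are no internal
-- leaves.
theorem WTree.inputs_pos (T : WTree) (hs : T.Stable) (hw : T.weight = 0) : 1 ≤ T.inputs :=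
  match T, hs, hw with
  | .input, _, _ => le_refl 1
  | .node w ts, hs, hw => by
    simp only [WTree.Stable, WTree.weight] at hs hw
    have := length_le_forestInputs ts hs.2 (by omega)
    have h := hs.1
    simp only [WTree.inputs]
    omega
theorem length_le_forestInputs (ts : List WTree) (hs : ForestStable ts) (hw : forestWeight ts = 0) :
    ts.length ≤ forestInputs ts :=
  match ts, hs, hw with
  | [], _, _ => le_refl 0
  | t :: ts, hs, hw => by
    simp only [ForestStable, forestWeight] at hs hw
    have h1 := WTree.inputs_pos t hs.1 (by omega)
    have h2 := length_le_forestInputs ts hs.2 (by omega)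
    simp only [forestInputs, List.length_cons]
    omega
end

/-- The tree with a single vertex, of weight zero, and two subtrees. -/
abbrev WTree.pair (a b : WTree) : WTree := .node 0 [a, b]

/-- The corolla of weight zero. -/
abbrev WTree.star (n : ℕ) : WTree := .node 0 (List.replicate n .input)

theorem WTree.eq_node {T : WTree} (hs : T.Stable) (hw : T.weight = 0) (hi : T.inputs ≠ 1) :
    ∃ ts, T = .node 0 ts ∧ 2 ≤ ts.length ∧ ForestStable ts ∧ forestWeight ts = 0 := by
  cases T with
  | input => exact absurd rfl hi
  | node w ts =>
    simp only [WTree.Stable, WTree.weight] at hs hw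
    obtain ⟨rfl, hw'⟩ : w = 0 ∧ forestWeight ts = 0 := by omega
    exact ⟨ts, rfl, by have := hs.1; omega, hs.2, hw'⟩

theorem WTree.eq_input {T : WTree} (hs : T.Stable) (hw : T.weight = 0) (hi : T.inputs = 1) :
    T = .input := by
  cases T with
  | input => rfl
  | node w ts =>
    simp only [WTree.Stable, WTree.weight, WTree.inputs] at hs hw hi
    have := length_le_forestInputs ts hs.2 (by omega)
    have h := hs.1
    omega

theorem WTree.eq_of_inputs_eq_two {T : WTree} (hs : T.Stable) (hw : T.weight = 0)
    (hi : T.inputs = 2) : T = .pair .input .input := by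
  obtain ⟨ts, rfl, hl, hs, hw⟩ := WTree.eq_node hs hw (by omega)
  have := length_le_forestInputs ts hs hw
  match ts, hl, hs, hw, hi with
  | [a, b], _, hs, hw, hi =>
    simp only [ForestStable, forestWeight, WTree.inputs, forestInputs] at hs hw hi
    have ha := a.inputs_pos hs.1 (by omega)
    have hb := b.inputs_pos hs.2.1 (by omega)
    rw [a.eq_input hs.1 (by omega) (by omega), b.eq_input hs.2.1 (by omega) (by omega)]
  | a :: b :: c :: ts, _, _, _, hi => simp only [WTree.inputs, List.length_cons] at this hi; omega

theorem WTree.eq_of_inputs_eq_three {T : WTree} (hs : T.Stable) (hw : T.weight = 0)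
    (hi : T.inputs = 3) : T = .star 3 ∨ T = .pair (.pair .input .input) .input ∨
      T = .pair .input (.pair .input .input) := by
  obtain ⟨ts, rfl, hl, hs, hw⟩ := WTree.eq_node hs hw (by omega)
  have := length_le_forestInputs ts hs hw
  match ts, hl, hs, hw, hi with
  | [a, b], _, hs, hw, hi =>
    simp only [ForestStable, forestWeight, WTree.inputs, forestInputs] at hs hw hi
    have ha := a.inputs_pos hs.1 (by omega)
    have hb := b.inputs_pos hs.2.1 (by omega)
    obtain h | h : a.inputs = 1 ∨ a.inputs = 2 := by omega
    · rw [a.eq_input hs.1 (by omega) h, b.eq_of_inputs_eq_two hs.2.1 (by omega) (by omega)]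
      exact Or.inr (Or.inr rfl)
    · rw [a.eq_of_inputs_eq_two hs.1 (by omega) h, b.eq_input hs.2.1 (by omega) (by omega)]
      exact Or.inr (Or.inl rfl)
  | [a, b, c], _, hs, hw, hi =>
    simp only [ForestStable, forestWeight, WTree.inputs, forestInputs] at hs hw hi
    have ha := a.inputs_pos hs.1 (by omega)
    have hb := b.inputs_pos hs.2.1 (by omega)
    have hc := c.inputs_pos hs.2.2.1 (by omega)
    rw [a.eq_input hs.1 (by omega) (by omega), b.eq_input hs.2.1 (by omega) (by omega),
      c.eq_input hs.2.2.1 (by omega) (by omega)]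
    exact Or.inl rfl
  | a :: b :: c :: d :: ts, _, _, _, hi =>
    simp only [WTree.inputs, List.length_cons] at this hi; omega

/-- The binary trees with four inputs. -/
def binaryTrees : List WTree :=
  [.pair (.pair (.pair .input .input) .input) .input,
    .pair (.pair .input (.pair .input .input)) .input,
    .pair (.pair .input .input) (.pair .input .input),
    .pair .input (.pair (.pair .input .input) .input),
    .pair .input (.pair .input (.pair .input .input))]

/-- Three is the maximal number of vertices for four inputs; a root with three or four subtrees
leaves room for fewer. -/
theorem WTree.mem_binaryTrees {T : WTree} (hs : T.Stable) (hw : T.weight = 0)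
    (hi : T.inputs = 4) (hv : T.vertices = 3) : T ∈ binaryTrees := by
  obtain ⟨ts, rfl, hl, hs, hw⟩ := WTree.eq_node hs hw (by omega)
  have := length_le_forestInputs ts hs hw
  simp only [binaryTrees, List.mem_cons, List.not_mem_nil, or_false]
  match ts, hl, hs, hw, hi with
  | [a, b], _, hs, hw, hi =>
    simp only [ForestStable, forestWeight, WTree.inputs, forestInputs, WTree.vertices,
      forestVertices] at hs hw hi hv
    have ha := a.inputs_pos hs.1 (by omega)
    have hb := b.inputs_pos hs.2.1 (by omega)
    obtain h | h | h : a.inputs = 1 ∨ a.inputs = 2 ∨ a.inputs = 3 := by omega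
    · rw [a.eq_input hs.1 (by omega) h] at hv ⊢
      rcases b.eq_of_inputs_eq_three hs.2.1 (by omega) (by omega) with rfl | rfl | rfl
      · simp [WTree.vertices, forestVertices] at hv
      · simp
      · simp
    · rw [a.eq_of_inputs_eq_two hs.1 (by omega) h, b.eq_of_inputs_eq_two hs.2.1 (by omega) (by omega)]
      simp
    · rw [b.eq_input hs.2.1 (by omega) (by omega)] at hv ⊢
      rcases a.eq_of_inputs_eq_three hs.1 (by omega) (by omega) with rfl | rfl | rfl
      · simp [WTree.vertices, forestVertices] at hv
      · simp
      · simp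
  | [a, b, c], _, hs, hw, hi =>
    exfalso
    simp only [ForestStable, forestWeight, WTree.inputs, forestInputs, WTree.vertices,
      forestVertices] at hs hw hi hv
    have key : ∀ t : WTree, t.Stable → t.weight = 0 → t.inputs ≤ 2 → t.vertices + 1 ≤ t.inputs := by
      intro t h1 h2 h3
      obtain h | h : t.inputs = 1 ∨ t.inputs = 2 := by
        have := t.inputs_pos h1 h2
        omega
      · rw [t.eq_input h1 h2 h]; decide
      · rw [t.eq_of_inputs_eq_two h1 h2 h]; decide
    have ha := a.inputs_pos hs.1 (by omega)
    have hb := b.inputs_pos hs.2.1 (by omega)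
    have hc := c.inputs_pos hs.2.2.1 (by omega)
    have ka := key a hs.1 (by omega) (by omega)
    have kb := key b hs.2.1 (by omega) (by omega)
    have kc := key c hs.2.2.1 (by omega) (by omega)
    omega
  | [a, b, c, d], _, hs, hw, hi =>
    exfalso
    simp only [ForestStable, forestWeight, WTree.inputs, forestInputs, WTree.vertices,
      forestVertices] at hs hw hi hv
    have ha := a.inputs_pos hs.1 (by omega)
    have hb := b.inputs_pos hs.2.1 (by omega)
    have hc := c.inputs_pos hs.2.2.1 (by omega)
    have hd := d.inputs_pos hs.2.2.2.1 (by omega)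
    rw [a.eq_input hs.1 (by omega) (by omega), b.eq_input hs.2.1 (by omega) (by omega),
      c.eq_input hs.2.2.1 (by omega) (by omega), d.eq_input hs.2.2.2.1 (by omega) (by omega)] at hv
    simp [WTree.vertices] at hv
  | a :: b :: c :: d :: e :: ts, _, _, _, hi =>
    simp only [WTree.inputs, List.length_cons] at this hi; omega

theorem eq_replicate_of_forestVertices_eq_zero {ts : List WTree} (h : forestVertices ts = 0) :
    ts = List.replicate (forestInputs ts) .input := by
  induction ts with
  | nil => rfl
  | cons t ts ih =>
    cases t with
    | input =>
      simp only [forestVertices, WTree.vertices, forestInputs, WTree.inputs] at h ⊢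
      rw [add_comm, List.replicate_succ, ← ih (by omega)]
    | node w us => simp [forestVertices, WTree.vertices] at h

theorem WTree.eq_star {T : WTree} (hw : T.weight = 0) (hv : T.vertices = 1) :
    T = .star T.inputs := by
  cases T with
  | input => simp [WTree.vertices] at hv
  | node w ts =>
    simp only [WTree.weight, WTree.vertices] at hw hv
    rw [WTree.inputs, WTree.star, ← eq_replicate_of_forestVertices_eq_zero (by omega)]
    congr
    omega

-- The diagonal in arities three and four.

theorem compChain_add_left (n : ℕ) (c c' d : PairChain) :
    compChain n (c + c') d = compChain n c d + compChain n c' d := by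
  classical
  unfold compChain
  refine Finsupp.sum_add_index' (fun _ => by simp) fun p a b => ?_
  rw [← Finsupp.sum_add]
  simp only [add_mul, add_smul]

theorem compChain_add_right (n : ℕ) (c d d' : PairChain) :
    compChain n c (d + d') = compChain n c d + compChain n c d' := by
  classical
  unfold compChain
  rw [← Finsupp.sum_add]
  congr 1
  funext p a
  exact Finsupp.sum_add_index' (fun _ => by simp) fun p a b => by simp only [mul_add, add_smul]

theorem compChain_single (n : ℕ) (p q : GTree × GTree) (a b : ZMod 2) :
    compChain n (Finsupp.single p a) (Finsupp.single q b) =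
      (a * b) • ∑ i ∈ Finset.range n, compPair p i q := by
  simp [compChain]

@[simp] theorem compChain_zero_left (n : ℕ) (d : PairChain) : compChain n 0 d = 0 := by
  simp [compChain]

@[simp] theorem compChain_zero_right (n : ℕ) (c : PairChain) : compChain n c 0 = 0 := by
  simp [compChain]

theorem GTree.exists_tree {p : GTree} {n : ℕ} (h : p.inputs = n) (hn : n ≠ 0) :
    ∃ t, p = .tree t := by
  cases p with
  | stump => exact absurd h.symm hn
  | tree t => exact ⟨t, rfl⟩

namespace WeightedAlgebraDiagonal
variable (Γ : WeightedAlgebraDiagonal)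

/-- The relation for the boundary of `Γ^{3,0}`. -/
theorem compat_three (p : GTree × GTree) (h1 : p.1.Stable) (h2 : p.2.Stable) :
    boundaryCoeff (Γ.cell 3 0) p = compChain 2 (Γ.cell 2 0) (Γ.cell 2 0) p := by
  rw [Γ.compat 3 0 (by norm_num) p h1 h2]
  simp [Finset.Nat.antidiagonal_succ, Γ.cell_eq_zero 0 0, Γ.cell_eq_zero 1 0]

/-- The relation for the boundary of `Γ^{4,0}`. -/
theorem compat_four (p : GTree × GTree) (h1 : p.1.Stable) (h2 : p.2.Stable) :
    boundaryCoeff (Γ.cell 4 0) p = compChain 2 (Γ.cell 2 0) (Γ.cell 3 0) p +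
      compChain 3 (Γ.cell 3 0) (Γ.cell 2 0) p := by
  rw [Γ.compat 4 0 (by norm_num) p h1 h2]
  simp [Finset.Nat.antidiagonal_succ, Γ.cell_eq_zero 0 0, Γ.cell_eq_zero 1 0]

/-- The dimensions must add up to `1`; the corolla has dimension `1` and the two binary trees have
dimension `0`, so exactly one factor is the corolla. -/
theorem mem_cell_three {p : GTree × GTree} (hp : p ∈ (Γ.cell 3 0).support) :
    p = (.tree (.pair (.pair .input .input) .input), .tree (.star 3)) ∨
    p = (.tree (.pair .input (.pair .input .input)), .tree (.star 3)) ∨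
    p = (.tree (.star 3), .tree (.pair (.pair .input .input) .input)) ∨
    p = (.tree (.star 3), .tree (.pair .input (.pair .input .input))) := by
  obtain ⟨⟨s1, i1, w1⟩, ⟨s2, i2, w2⟩, hd⟩ := Γ.mem 3 0 p hp
  obtain ⟨p1, p2⟩ := p
  obtain ⟨t1, rfl⟩ := GTree.exists_tree i1 (by norm_num)
  obtain ⟨t2, rfl⟩ := GTree.exists_tree i2 (by norm_num)
  rcases WTree.eq_of_inputs_eq_three s1 (Nat.le_zero.1 w1) i1 with rfl | rfl | rfl <;>
  rcases WTree.eq_of_inputs_eq_three s2 (Nat.le_zero.1 w2) i2 with rfl | rfl | rfl <;>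
  simp [GTree.dim, WTree.vertices, WTree.weight, WTree.inputs, forestInputs, forestWeight,
    forestVertices, List.replicate] at hd ⊢

/-- With `L` and `R` the left and right binary trees, `Γ^{2,0} ∘ Γ^{2,0} = L ⊗ L + R ⊗ R`. The
coefficients of `L ⊗ L`, `R ⊗ L` and `L ⊗ R` in the boundary give `a + c = 1`, `b + c = 0` and `a +
d = 0`. -/
theorem exists_cell_three : ∃ a b c d : ZMod 2, a + b = 1 ∧ c + d = 1 ∧ Γ.cell 3 0 =
    Finsupp.single (.tree (.pair (.pair .input .input) .input), .tree (.star 3)) a +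
    Finsupp.single (.tree (.pair .input (.pair .input .input)), .tree (.star 3)) b +
    Finsupp.single (.tree (.star 3), .tree (.pair (.pair .input .input) .input)) c +
    Finsupp.single (.tree (.star 3), .tree (.pair .input (.pair .input .input))) d := by
  classical
  have hcell : Γ.cell 3 0 =
      Finsupp.single (.tree (.pair (.pair .input .input) .input), .tree (.star 3))
        (Γ.cell 3 0 (.tree (.pair (.pair .input .input) .input), .tree (.star 3))) +
      Finsupp.single (.tree (.pair .input (.pair .input .input)), .tree (.star 3))
        (Γ.cell 3 0 (.tree (.pair .input (.pair .input .input)), .tree (.star 3))) +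
      Finsupp.single (.tree (.star 3), .tree (.pair (.pair .input .input) .input))
        (Γ.cell 3 0 (.tree (.star 3), .tree (.pair (.pair .input .input) .input))) +
      Finsupp.single (.tree (.star 3), .tree (.pair .input (.pair .input .input)))
        (Γ.cell 3 0 (.tree (.star 3), .tree (.pair .input (.pair .input .input)))) := by
    conv_lhs => rw [← Finsupp.sum_single (Γ.cell 3 0)]
    rw [Finsupp.sum_of_support_subset (s :=
      {(.tree (.pair (.pair .input .input) .input), .tree (.star 3)),
        (.tree (.pair .input (.pair .input .input)), .tree (.star 3)),
        (.tree (.star 3), .tree (.pair (.pair .input .input) .input)),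
        (.tree (.star 3), .tree (.pair .input (.pair .input .input)))})]
    · rw [Finset.sum_insert, Finset.sum_insert, Finset.sum_insert, Finset.sum_singleton]
      · simp only [add_assoc]
      all_goals simp [List.replicate]
    · intro p hp
      simpa using Γ.mem_cell_three hp
    · simp
  have e1 := Γ.compat_three
    (.tree (.pair (.pair .input .input) .input), .tree (.pair (.pair .input .input) .input))
    (by simp [GTree.Stable, WTree.Stable, ForestStable])
    (by simp [GTree.Stable, WTree.Stable, ForestStable])
  have e2 := Γ.compat_three
    (.tree (.pair .input (.pair .input .input)), .tree (.pair (.pair .input .input) .input))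
    (by simp [GTree.Stable, WTree.Stable, ForestStable])
    (by simp [GTree.Stable, WTree.Stable, ForestStable])
  have e3 := Γ.compat_three
    (.tree (.pair (.pair .input .input) .input), .tree (.pair .input (.pair .input .input)))
    (by simp [GTree.Stable, WTree.Stable, ForestStable])
    (by simp [GTree.Stable, WTree.Stable, ForestStable])
  refine ⟨_, _, _, _, ?_, ?_, hcell⟩
  all_goals
    simp [Γ.cell_two_zero, compChain_single, boundaryCoeff, GTree.collapses, WTree.collapses,
      forestCollapses, GTree.corolla, compPair, GTree.comp, WTree.graft, forestGraft, WTree.inputs,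
      Finset.sum_range_succ, List.replicate] at e1 e2 e3 ⊢
    grind

/-- The second factor `T` is a corolla with three inputs and a binary vertex grafted into the first
one; its only collapse is the corolla. Sum the relation at `(S, T)` over the vertices `S` of the
pentagon: each edge of the pentagon has two ends, so the terms from collapses of `S` cancel. On the
right-hand side, `T` arises only by grafting `Γ^{2,0}` into the first input of the terms of
`Γ^{3,0}` whose second factor is the corolla, which leaves `a + b = 1`. -/
theorem sum_cell_four_left :
    (binaryTrees.map fun S => Γ.cell 4 0 (.tree S, .tree (.star 4))).sum = 1 := by
  classical
  obtain ⟨a, b, c, d, hab, -, hcell⟩ := Γ.exists_cell_three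
  have e : ∀ S ∈ binaryTrees, S.Stable → _ := fun S _ hS =>
    Γ.compat_four (.tree S, .tree (.node 0 [.pair .input .input, .input, .input])) hS
      (by simp [GTree.Stable, WTree.Stable, ForestStable])
  simp only [hcell, Γ.cell_two_zero, compChain_add_left, compChain_add_right, compChain_single,
    binaryTrees, List.forall_mem_cons] at e
  obtain ⟨e1, e2, e3, e4, e5, -⟩ := e
  simp [boundaryCoeff, GTree.collapses, WTree.collapses, WTree.Stable, ForestStable,
    forestCollapses, GTree.corolla, compPair, GTree.comp, WTree.graft, forestGraft, WTree.inputs,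
    forestInputs, Finset.sum_range_succ, List.replicate, binaryTrees] at e1 e2 e3 e4 e5 ⊢
  grind

theorem sum_cell_four_right :
    (binaryTrees.map fun S => Γ.cell 4 0 (.tree (.star 4), .tree S)).sum = 1 := by
  classical
  obtain ⟨a, b, c, d, -, hcd, hcell⟩ := Γ.exists_cell_three
  have e : ∀ S ∈ binaryTrees, S.Stable → _ := fun S _ hS =>
    Γ.compat_four (.tree (.node 0 [.pair .input .input, .input, .input]), .tree S)
      (by simp [GTree.Stable, WTree.Stable, ForestStable]) hS
  simp only [hcell, Γ.cell_two_zero, compChain_add_left, compChain_add_right, compChain_single,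
    binaryTrees, List.forall_mem_cons] at e
  obtain ⟨e1, e2, e3, e4, e5, -⟩ := e
  simp [boundaryCoeff, GTree.collapses, WTree.collapses, WTree.Stable, ForestStable,
    forestCollapses, GTree.corolla, compPair, GTree.comp, WTree.graft, forestGraft, WTree.inputs,
    forestInputs, Finset.sum_range_succ, List.replicate, binaryTrees] at e1 e2 e3 e4 e5 ⊢
  grind

end WeightedAlgebraDiagonal

-- The disk consisting of a single square.

/-- A square glued to itself would have to be developed to two different positions. -/
theorem Tiling.nb_eq_none_of_one (T : Tiling 1) (t : Fin 1) (s : ZMod 4) : T.nb t s = none := by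
  obtain ⟨pos, hpos⟩ := T.develops
  cases h : T.nb t s with
  | none => rfl
  | some t' =>
    have := hpos t s t' h
    rw [Subsingleton.elim t' t] at this
    have h0 : ∀ s, shift s ≠ 0 := by decide
    exact absurd (by simpa using this) (h0 s)

theorem Tiling.eq_of_one (T T' : Tiling 1) : T = T' := by
  have h : T.nb = T'.nb := by
    funext t s
    rw [T.nb_eq_none_of_one, T'.nb_eq_none_of_one]
  cases T
  cases T'
  congr

/-- A single unit square. -/
def Tiling.square : Tiling 1 where
  nb _ _ := none
  symm _ _ _ h := nomatch h
  develops := ⟨fun _ => 0, fun _ _ _ h => nomatch h⟩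

theorem Tiling.square_iterate (i : ZMod 4) (p : ℕ) :
    Tiling.square.step^[p] (0, i) = (0, i - p) := by
  induction p with
  | zero => simp
  | succ p ih =>
    rw [Function.iterate_succ_apply', ih]
    simp only [Tiling.step, Tiling.square]
    push_cast
    rw [sub_sub]

theorem letters_square (i : ZMod 4) : letters [(i, 0), (i - 1, 0), (i - 2, 0), (i - 3, 0)] =
    [(i, true), (i - 1, true), (i - 2, true), (i - 3, true)] := by
  simp [letters]

theorem isDisk_square (i : ZMod 4) :
    IsDisk Tiling.square (0, i) [(i, 0), (i - 1, 0), (i - 2, 0), (i - 3, 0)] 0 where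
  connected t := by rw [Subsingleton.elim t 0]
  reads p hp := by
    have h4 : p < 4 := by rw [letters_square] at hp; exact hp
    simp only [letters_square, Tiling.square_iterate]
    interval_cases p <;> simp [Tiling.IsLast, Tiling.square]
  closed := by
    rw [letters_square, Tiling.square_iterate]
    simp only [List.length_cons, List.length_nil, Prod.mk.injEq, true_and]
    revert i
    decide
  once := by
    rw [letters_square]
    intro p hp q hq h
    simp only [Tiling.square_iterate, Prod.mk.injEq, true_and, sub_right_inj] at h
    simp only [Set.mem_Iio, List.length_cons, List.length_nil] at hp hq
    interval_cases p <;> interval_cases q <;> first | rfl | exact absurd h (by decide)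
  interior c hc := by
    exfalso
    obtain ⟨t, j⟩ := c
    refine hc (i - j).val ?_ ?_
    · rw [letters_square]; exact ZMod.val_lt _
    · rw [Tiling.square_iterate, ZMod.natCast_zmod_val, sub_sub_cancel, Subsingleton.elim t 0]
  interior_count := by rw [letters_square]; rfl
  euler := rfl

/-- There is only one tiling with one tile, and the first letter determines the base corner. -/
theorem card_square (i : ZMod 4) : Nat.card (Quot (BasedDisk.Iso (k := 1)
    (word := [(i, 0), (i - 1, 0), (i - 2, 0), (i - 3, 0)]) (w := 0))) = 1 := by
  rw [Nat.card_eq_one_iff_unique]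
  refine ⟨⟨fun a b => ?_⟩, ⟨Quot.mk _ ⟨(Tiling.square, (0, i)), isDisk_square i⟩⟩⟩
  obtain ⟨⟨⟨T, c⟩, h⟩, rfl⟩ := Quot.exists_rep a
  obtain ⟨⟨⟨T', c'⟩, h'⟩, rfl⟩ := Quot.exists_rep b
  have e : ∀ (T : Tiling 1) (c : Fin 1 × ZMod 4),
      IsDisk T c [(i, 0), (i - 1, 0), (i - 2, 0), (i - 3, 0)] 0 → c = (0, i) := by
    intro T c h
    have := (h.reads 0 (by rw [letters_square]; exact Nat.zero_lt_succ _)).1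
    simp only [letters_square] at this
    exact Prod.ext (Subsingleton.elim _ _) this
  obtain rfl : T = T' := Tiling.eq_of_one T T'
  obtain rfl : c = c' := (e T c h).trans (e T c' h').symm
  rfl

/-- The only disk with four corners is the square. -/
theorem diskCount_square (i : ZMod 4) :
    diskCount [(i, 0), (i - 1, 0), (i - 2, 0), (i - 3, 0)] 0 = 1 := by
  -- The type of disks depends on the number of tiles, so `tileCount` is replaced by a variable
  -- before it is evaluated.
  have key : ∀ k, k = 1 → Nat.card (Quot (BasedDisk.Iso (k := k)
      (word := [(i, 0), (i - 1, 0), (i - 2, 0), (i - 3, 0)]) (w := 0))) = 1 := by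
    rintro _ rfl
    exact card_square i
  exact key _ (by simp [tileCount])

-- Explicit values of the operations.

section
variable {R : Type} [CommRing R]

theorem extend_map_single (f : List Path → Alg R) (bs : List Path) :
    extend f (bs.map fun b => Finsupp.single b 1) = f bs := by
  induction bs generalizing f with
  | nil => rfl
  | cons b bs ih => simp [extend, ih]

theorem mu_map_single (u : R) (w : ℕ) (bs : List Path) :
    mu u w (bs.map fun b => Finsupp.single b 1) = basisOp u w bs :=
  extend_map_single _ _

theorem mu_rho_rho (u : R) (i j : ZMod 4) (l m : ℕ) :
    mu u 0 [rho R i l, rho R j m] = if j = i + l + 1 then rho R i (l + m + 1) else 0 := by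
  refine (mu_map_single u 0 [.chord i l, .chord j m]).trans ?_
  simp only [basisOp, Path.mul]
  split_ifs <;> rfl

theorem mu_iota_right (u : R) (c : Alg R) (k : Fin 2) :
    mu u 0 [c, iota R k] = c.filter fun b => b.tgt = k := by
  have h : ∀ b, basisOp u 0 [b, Path.idem k] = if b.tgt = k then Finsupp.single b (1 : R) else 0 := by
    intro b
    cases b with
    | idem i =>
      simp only [basisOp, Path.mul, Path.src, Path.tgt]
      by_cases h : k = i
      · simp [h]
      · simp [h, Ne.symm h]
    | chord i l =>
      simp only [basisOp, Path.mul]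
      split_ifs <;> rfl
  simp only [mu, extend, iota, Finsupp.sum_single_index, zero_smul, one_smul, h]
  conv_rhs => rw [← Finsupp.sum_single c]
  rw [Finsupp.sum, Finsupp.sum, Finsupp.filter_sum]
  refine Finset.sum_congr rfl fun b _ => ?_
  by_cases hb : b.tgt = k
  · rw [if_pos hb, Finsupp.filter_single_of_pos (fun b : Path => b.tgt = k) hb,
      Finsupp.smul_single, smul_eq_mul, mul_one]
  · rw [if_neg hb, Finsupp.filter_single_of_neg (fun b : Path => b.tgt = k) hb, smul_zero]

theorem mu_square (u : R) (i : ZMod 4) :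
    mu u 0 [rho R i 0, rho R (i - 1) 0, rho R (i - 2) 0, rho R (i - 3) 0] = u • iota R (arc i) := by
  refine (mu_map_single u 0 [.chord i 0, .chord (i - 1) 0, .chord (i - 2) 0,
    .chord (i - 3) 0]).trans ?_
  simp [basisOp, Path.toChord, diskOp, diskCount_square, tileCount, iota]

theorem mu_curvature (u : R) :
    mu u 1 [] = rho R 0 3 + rho R 1 3 + rho R 2 3 + rho R 3 3 :=
  Fin.sum_univ_four (fun i : ZMod 4 => (Finsupp.single (Path.chord i 3) 1 : Alg R))

/-- One input of weight zero has the wrong parity: `1 = 2 * k + 2` is impossible. -/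
theorem mu_single_rho (u : R) (i : ZMod 4) (l : ℕ) : mu u 0 [rho R i l] = 0 := by
  by_contra h
  obtain ⟨b, hb⟩ := exists_mem_support (r := (1 : R)) (by simpa using h)
  obtain ⟨_, _, k, hk, -⟩ := mu_grading hb
  simp only [List.length_cons, List.length_nil] at hk
  omega

/-- By associativity the value does not depend on the tree; hence only the sum of the coefficients
of a diagonal on binary trees matters. -/
theorem eval_binary (u : R) {S : WTree} (hS : S ∈ binaryTrees) (i j k l : ZMod 4) :
    S.eval u [rho R i 0, rho R j 0, rho R k 0, rho R l 0] =
      if j = i + 1 ∧ k = i + 2 ∧ l = i + 3 then rho R i 3 else 0 := by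
  have z1 : ∀ a : Alg R, mu u 0 [0, a] = 0 := fun a => mu_eq_zero_of_mem (by simp)
  have z2 : ∀ a : Alg R, mu u 0 [a, 0] = 0 := fun a => mu_eq_zero_of_mem (by simp)
  have e1 : ∀ i : ZMod 4, i + 1 + 1 = i + 2 := by decide
  have e2 : ∀ i : ZMod 4, i + 2 + 1 = i + 3 := by decide
  have e3 : ∀ i : ZMod 4, i + 1 + 2 = i + 3 := by decide
  simp only [binaryTrees, List.mem_cons, List.not_mem_nil, or_false] at hS
  rcases hS with rfl | rfl | rfl | rfl | rfl <;>
    simp [WTree.eval, forestEval, WTree.inputs, forestInputs, mu_rho_rho] <;>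
    by_cases hj : j = i + 1 <;> by_cases hk : k = j + 1 <;> by_cases hl : l = k + 1 <;>
    simp_all [mu_rho_rho]

end

-- Operations of the tensor product on the terms of the structure map.

section
variable {R₁ R₂ : Type} [CommRing R₁] [CommRing R₂] [Algebra (ZMod 2) R₁] [Algebra (ZMod 2) R₂]

theorem tensorAt_eq (u₁ : R₁) (u₂ : R₂) (e : Fin 2 × Fin 2) (c : Alg R₁) (d : Alg R₂) :
    tensorAt u₁ u₂ e c d =
      (c.filter fun b => b.tgt = e.1) ⊗ₜ[ZMod 2] (d.filter fun b => b.tgt = e.2) := by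
  rw [tensorAt, mu_iota_right, mu_iota_right]

/-- The operation `μ₄⁰` on the tensor product consists of the terms with one factor an iterated
product and the other one the centered operation `μ₄⁰`. -/
theorem sum_cell_four (Γ : WeightedAlgebraDiagonal) {M : Type} [AddCommGroup M] [Module (ZMod 2) M]
    (g : GTree × GTree → M) (V₁ V₂ : M)
    (h₁ : ∀ S ∈ binaryTrees, g (.tree S, .tree (.star 4)) = V₁)
    (h₂ : ∀ S ∈ binaryTrees, g (.tree (.star 4), .tree S) = V₂)
    (h : ∀ p ∈ (Γ.cell 4 0).support, g p ≠ 0 → ∃ K₁ K₂ : ℕ, (2 * K₁ : ℤ) = p.1.dim ∧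
      (2 * K₂ : ℤ) = p.2.dim ∧ 2 * K₁ + 2 * K₂ + 2 = 4 + 2 * 0) :
    ((Γ.cell 4 0).sum fun p c => c • g p) = V₁ + V₂ := by
  classical
  set l : List (GTree × GTree) := binaryTrees.map (fun S => (.tree S, .tree (.star 4))) ++
    binaryTrees.map (fun S => (.tree (.star 4), .tree S)) with hl
  have hnd : l.Nodup := by
    simp [hl, binaryTrees, List.replicate]
  have hsum : ((Γ.cell 4 0).sum fun p c => c • g p) = ∑ p ∈ l.toFinset, Γ.cell 4 0 p • g p := by
    rw [Finsupp.sum]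
    refine Finset.sum_congr_of_eq_on_inter ?_ ?_ fun p _ _ => rfl
    · intro p hp hpl
      by_contra hne
      obtain ⟨K₁, K₂, hK₁, hK₂, hK⟩ := h p hp (right_ne_zero_of_smul hne)
      obtain ⟨⟨s1, i1, w1⟩, ⟨s2, i2, w2⟩, hd⟩ := Γ.mem 4 0 p hp
      obtain ⟨p1, p2⟩ := p
      obtain ⟨t1, rfl⟩ := GTree.exists_tree i1 (by norm_num)
      obtain ⟨t2, rfl⟩ := GTree.exists_tree i2 (by norm_num)
      simp only [GTree.inputs, GTree.weight, GTree.dim, GTree.Stable, Nat.le_zero] at *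
      rw [i1, w1] at hK₁
      rw [i2, w2] at hK₂
      apply hpl
      simp only [hl, List.mem_toFinset, List.mem_append, List.mem_map]
      -- Both dimensions are even and their sum is `2`, so one tree has dimension `0` and three
      -- vertices, and the other has dimension `2` and one vertex.
      obtain hv | hv : t1.vertices = 3 ∧ t2.vertices = 1 ∨ t1.vertices = 1 ∧ t2.vertices = 3 := by
        push_cast at hK₁ hK₂
        omega
      · refine Or.inl ⟨t1, WTree.mem_binaryTrees s1 w1 i1 hv.1, ?_⟩
        rw [WTree.eq_star w2 hv.2, i2]
      · refine Or.inr ⟨t2, WTree.mem_binaryTrees s2 w2 i2 hv.2, ?_⟩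
        rw [WTree.eq_star w1 hv.1, i1]
    · intro p _ hp
      rw [Finsupp.notMem_support_iff.1 hp, zero_smul]
  have e1 : (binaryTrees.map fun S => Γ.cell 4 0 (.tree S, .tree (.star 4)) •
      g (.tree S, .tree (.star 4))) =
      binaryTrees.map fun S => Γ.cell 4 0 (.tree S, .tree (.star 4)) • V₁ :=
    List.map_congr_left fun S hS => by rw [h₁ S hS]
  have e2 : (binaryTrees.map fun S => Γ.cell 4 0 (.tree (.star 4), .tree S) •
      g (.tree (.star 4), .tree S)) =
      binaryTrees.map fun S => Γ.cell 4 0 (.tree (.star 4), .tree S) • V₂ :=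
    List.map_congr_left fun S hS => by rw [h₂ S hS]
  rw [hsum, List.sum_toFinset _ hnd, hl, List.map_append, List.sum_append, List.map_map,
    List.map_map]
  simp only [Function.comp_def]
  have e3 : ∀ (f : WTree → ZMod 2) (V : M),
      (binaryTrees.map fun S => f S • V).sum = (binaryTrees.map f).sum • V := fun f V => by
    rw [List.sum_smul, List.map_map, Function.comp_def]
  rw [e1, e2, e3, e3, Γ.sum_cell_four_left, Γ.sum_cell_four_right, one_smul, one_smul]

theorem tensorAt_zero_left (u₁ : R₁) (u₂ : R₂) (e : Fin 2 × Fin 2) (d : Alg R₂) :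
    tensorAt u₁ u₂ e 0 d = 0 := by
  by_contra h
  exact (tensorAt_ne_zero h).1 rfl

theorem tensorAt_zero_right (u₁ : R₁) (u₂ : R₂) (e : Fin 2 × Fin 2) (c : Alg R₁) :
    tensorAt u₁ u₂ e c 0 = 0 := by
  by_contra h
  exact (tensorAt_ne_zero h).2 rfl

variable (Γ : WeightedAlgebraDiagonal) (u₁ : R₁) (u₂ : R₂)

theorem tensorOp_eq_sum {w : ℕ} {as : List (Alg R₁ × Alg R₂)} (h : ¬ (w = 0 ∧ as.length = 1))
    (e : Fin 2 × Fin 2) : tensorOp Γ u₁ u₂ w as e =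
      (Γ.cell as.length w).sum fun p c => c • pairOp u₁ u₂ w p as e := by
  unfold tensorOp
  split
  · exact absurd ⟨rfl, rfl⟩ h
  · rfl

theorem tensorOp_one (c : Chord × Chord) (e : Fin 2 × Fin 2) :
    tensorOp Γ u₁ u₂ 0 [chordPair R₁ R₂ c] e = 0 := by
  simp only [tensorOp, chordPair, mu_single_rho, tensorAt_zero_left, tensorAt_zero_right, add_zero]

theorem tensorOp_eq_zero {n w : ℕ} (h : (n, w) ∉ ({(0, 1), (2, 0), (4, 0)} : Finset (ℕ × ℕ)))
    {cs : List (Chord × Chord)} (hcs : ∀ c ∈ cs, c ∈ dualPairs) (hn : cs.length = n)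
    (e : Fin 2 × Fin 2) : tensorOp Γ u₁ u₂ w (cs.map (chordPair R₁ R₂)) e = 0 := by
  by_cases h1 : w = 0 ∧ (cs.map (chordPair R₁ R₂)).length = 1
  · obtain ⟨rfl, h1⟩ := h1
    rw [List.length_map] at h1
    obtain ⟨c, rfl⟩ := List.length_eq_one_iff.1 h1
    exact tensorOp_one Γ u₁ u₂ c e
  · rw [tensorOp_eq_sum Γ u₁ u₂ h1, List.length_map, hn]
    refine Finset.sum_eq_zero fun p hp => ?_
    by_contra hne
    exact h (pairOp_cases Γ hp hcs hn (right_ne_zero_of_smul hne))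

/-- For `n = 4` and `w = 0` the relation `n + m + 4 * w = 4` gives `m = 0`, so long chords are
excluded. -/
theorem tensorOp_four_eq_zero {cs : List (Chord × Chord)} (hcs : ∀ c ∈ cs, c ∈ dualPairs)
    (hn : cs.length = 4) (hlong : ∃ c ∈ cs, c.1.2 ≠ 0) (e : Fin 2 × Fin 2) :
    tensorOp Γ u₁ u₂ 0 (cs.map (chordPair R₁ R₂)) e = 0 := by
  rw [tensorOp_eq_sum Γ u₁ u₂ (by simp [hn]), List.length_map, hn]
  refine Finset.sum_eq_zero fun p hp => ?_
  by_contra hne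
  obtain ⟨-, h2, -⟩ := pairOp_constraints Γ hp hcs hn (right_ne_zero_of_smul hne)
  obtain ⟨c, hc, hne⟩ := hlong
  have := List.single_le_sum (fun _ _ => Nat.zero_le _) c.1.2
    (List.mem_map_of_mem (f := fun c : Chord × Chord => c.1.2) hc)
  omega

theorem eval_star_four {R : Type} [CommRing R] (u : R) (a b c d : Alg R) :
    (WTree.star 4).eval u [a, b, c, d] = mu u 0 [a, b, c, d] := by
  simp [WTree.eval, forestEval, WTree.inputs, List.replicate]

theorem tensorOp_four (i j k l i' j' k' l' : ZMod 4)
    (hcs : ∀ c ∈ [((i, 0), (i', 0)), ((j, 0), (j', 0)), ((k, 0), (k', 0)), ((l, 0), (l', 0))],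
      c ∈ dualPairs) (e : Fin 2 × Fin 2) :
    tensorOp Γ u₁ u₂ 0 ([((i, 0), (i', 0)), ((j, 0), (j', 0)), ((k, 0), (k', 0)),
        ((l, 0), (l', 0))].map (chordPair R₁ R₂)) e =
      tensorAt u₁ u₂ e (if j = i + 1 ∧ k = i + 2 ∧ l = i + 3 then rho R₁ i 3 else 0)
        (mu u₂ 0 [rho R₂ i' 0, rho R₂ j' 0, rho R₂ k' 0, rho R₂ l' 0]) +
      tensorAt u₁ u₂ e (mu u₁ 0 [rho R₁ i 0, rho R₁ j 0, rho R₁ k 0, rho R₁ l 0])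
        (if j' = i' + 1 ∧ k' = i' + 2 ∧ l' = i' + 3 then rho R₂ i' 3 else 0) := by
  rw [tensorOp_eq_sum Γ u₁ u₂ (by simp)]
  refine sum_cell_four Γ (fun p => pairOp u₁ u₂ 0 p _ e) _ _ (fun S hS => ?_) (fun S hS => ?_) fun p hp hne =>
    (pairOp_constraints Γ hp hcs rfl hne).2.2
  · simp only [pairOp, chordPair, List.map_cons, List.map_nil, GTree.eval, eval_binary u₁ hS,
      eval_star_four, Nat.zero_sub, pow_zero, one_smul]
  · simp only [pairOp, chordPair, List.map_cons, List.map_nil, GTree.eval, eval_binary u₂ hS,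
      eval_star_four, Nat.zero_sub, pow_zero, one_smul]

theorem tensorOp_two (a b : Alg R₁ × Alg R₂) (e : Fin 2 × Fin 2) :
    tensorOp Γ u₁ u₂ 0 [a, b] e = tensorAt u₁ u₂ e (mu u₁ 0 [a.1, b.1]) (mu u₂ 0 [a.2, b.2]) := by
  rw [tensorOp_eq_sum Γ u₁ u₂ (by simp)]
  simp [Γ.cell_two_zero, pairOp, GTree.corolla, GTree.eval, WTree.eval, forestEval, WTree.inputs,
    List.replicate]

/-- The stump evaluates to the unit and has weight `0` in a cell of weight `1`, which accounts for
one factor `u₁` or `u₂`. -/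
theorem tensorOp_zero (e : Fin 2 × Fin 2) :
    tensorOp Γ u₁ u₂ 1 [] e =
      tensorAt u₁ u₂ e (mu u₁ 1 []) (mu u₂ 1 []) +
      tensorAt u₁ u₂ e (u₁ • (iota R₁ 0 + iota R₁ 1)) (mu u₂ 1 []) +
      tensorAt u₁ u₂ e (mu u₁ 1 []) (u₂ • (iota R₂ 0 + iota R₂ 1)) := by
  rw [tensorOp_eq_sum Γ u₁ u₂ (by simp)]
  simp only [List.length_nil, Γ.cell_zero_one]
  rw [Finsupp.sum_add_index' (by simp) (by simp [add_smul]),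
    Finsupp.sum_add_index' (by simp) (by simp [add_smul])]
  simp [pairOp, GTree.corolla, GTree.eval, WTree.eval, forestEval, GTree.weight,
    WTree.weight, forestWeight]

-- Enumeration of the terms of the iterated structure map.

/-- The sum of the terms of an operation of weight zero on the iterated structure map, preceded by
given terms. -/
def tailSum (pre : List (Chord × Chord)) (n : ℕ) (y : Fin 2) : Fin 2 → Alg R₁ ⊗[ZMod 2] Alg R₂ :=
  (((dualizingBimodule R₁ R₂).iter n y).map fun q =>
    Pi.single q.2 (tensorOp Γ u₁ u₂ 0 (pre.map (chordPair R₁ R₂) ++ q.1) (q.2, q.2))).sum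

theorem structureTerm_eq_tailSum (n : ℕ) (x : Fin 2) :
    (dualizingBimodule R₁ R₂).structureTerm Γ u₁ u₂ n 0 x = tailSum Γ u₁ u₂ [] n x := rfl

theorem tailSum_zero (pre : List (Chord × Chord)) (y : Fin 2) :
    tailSum Γ u₁ u₂ pre 0 y =
      Pi.single y (tensorOp Γ u₁ u₂ 0 (pre.map (chordPair R₁ R₂)) (y, y)) := by
  simp [tailSum, DDData.iter]

theorem tailSum_succ_zero (pre : List (Chord × Chord)) (n : ℕ) :
    tailSum Γ u₁ u₂ pre (n + 1) 0 =
      tailSum Γ u₁ u₂ (pre ++ [((1, 0), (3, 0))]) n 1 +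
      tailSum Γ u₁ u₂ (pre ++ [((3, 0), (1, 0))]) n 1 +
      tailSum Γ u₁ u₂ (pre ++ [((1, 2), (1, 2))]) n 1 +
      tailSum Γ u₁ u₂ (pre ++ [((3, 2), (3, 2))]) n 1 := by
  simp [tailSum, DDData.iter, dualizingBimodule, chordPair, Function.comp_def, add_assoc]

theorem tailSum_succ_one (pre : List (Chord × Chord)) (n : ℕ) :
    tailSum Γ u₁ u₂ pre (n + 1) 1 =
      tailSum Γ u₁ u₂ (pre ++ [((2, 0), (2, 0))]) n 0 +
      tailSum Γ u₁ u₂ (pre ++ [((4, 0), (4, 0))]) n 0 +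
      tailSum Γ u₁ u₂ (pre ++ [((2, 2), (4, 2))]) n 0 +
      tailSum Γ u₁ u₂ (pre ++ [((4, 2), (2, 2))]) n 0 := by
  simp [tailSum, DDData.iter, dualizingBimodule, chordPair, Function.comp_def, add_assoc]

theorem tailSum_eq_zero {pre : List (Chord × Chord)} {n : ℕ} (hpre : ∀ c ∈ pre, c ∈ dualPairs)
    (hn : pre.length + n = 4) (hlong : ∃ c ∈ pre, c.1.2 ≠ 0) (y : Fin 2) :
    tailSum Γ u₁ u₂ pre n y = 0 := by
  refine List.sum_eq_zero fun v hv => ?_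
  obtain ⟨q, hq, rfl⟩ := List.mem_map.1 hv
  obtain ⟨cs, h1, h2, h3⟩ := mem_iter hq
  obtain ⟨c, hc, hne⟩ := hlong
  rw [h3, ← List.map_append, tensorOp_four_eq_zero Γ u₁ u₂ (fun c hc => ?_) (by simp [h2, hn])
    ⟨c, by simp [hc], hne⟩, Pi.single_zero]
  rcases List.mem_append.1 hc with h | h
  · exact hpre c h
  · exact h1 c h

/-- Discarding long chords at each stage leaves two branches out of four, hence `16` words of length
four instead of `256`. -/
theorem tailSum_short_zero {pre : List (Chord × Chord)} {n : ℕ} (hpre : ∀ c ∈ pre, c ∈ dualPairs)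
    (hn : pre.length + (n + 1) = 4) :
    tailSum Γ u₁ u₂ pre (n + 1) 0 =
      tailSum Γ u₁ u₂ (pre ++ [((1, 0), (3, 0))]) n 1 +
      tailSum Γ u₁ u₂ (pre ++ [((3, 0), (1, 0))]) n 1 := by
  have h : ∀ c ∈ dualPairs, ∀ c' ∈ pre ++ [c], c' ∈ dualPairs := fun c hc c' hc' => by
    rcases List.mem_append.1 hc' with h | h
    · exact hpre c' h
    · rwa [List.mem_singleton.1 h]
  rw [tailSum_succ_zero,
    tailSum_eq_zero Γ u₁ u₂ (h ((1, 2), (1, 2)) (by decide)) (by simp; omega)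
      ⟨_, List.mem_append_right _ (List.mem_singleton_self _), by decide⟩,
    tailSum_eq_zero Γ u₁ u₂ (h ((3, 2), (3, 2)) (by decide)) (by simp; omega)
      ⟨_, List.mem_append_right _ (List.mem_singleton_self _), by decide⟩, add_zero, add_zero]

theorem tailSum_short_one {pre : List (Chord × Chord)} {n : ℕ} (hpre : ∀ c ∈ pre, c ∈ dualPairs)
    (hn : pre.length + (n + 1) = 4) :
    tailSum Γ u₁ u₂ pre (n + 1) 1 =
      tailSum Γ u₁ u₂ (pre ++ [((2, 0), (2, 0))]) n 0 +
      tailSum Γ u₁ u₂ (pre ++ [((4, 0), (4, 0))]) n 0 := by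
  have h : ∀ c ∈ dualPairs, ∀ c' ∈ pre ++ [c], c' ∈ dualPairs := fun c hc c' hc' => by
    rcases List.mem_append.1 hc' with h | h
    · exact hpre c' h
    · rwa [List.mem_singleton.1 h]
  rw [tailSum_succ_one,
    tailSum_eq_zero Γ u₁ u₂ (h ((2, 2), (4, 2)) (by decide)) (by simp; omega)
      ⟨_, List.mem_append_right _ (List.mem_singleton_self _), by decide⟩,
    tailSum_eq_zero Γ u₁ u₂ (h ((4, 2), (2, 2)) (by decide)) (by simp; omega)
      ⟨_, List.mem_append_right _ (List.mem_singleton_self _), by decide⟩, add_zero, add_zero]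

end

section
variable {R : Type} [CommRing R]

theorem filter_rho (i : ZMod 4) (l : ℕ) (k : Fin 2) :
    (rho R i l).filter (fun b => b.tgt = k) = if arc (i + l + 1) = k then rho R i l else 0 := by
  split_ifs with h
  · exact Finsupp.filter_single_of_pos (fun b : Path => b.tgt = k) h
  · exact Finsupp.filter_single_of_neg (fun b : Path => b.tgt = k) h

theorem filter_iota (i k : Fin 2) :
    (iota R i).filter (fun b => b.tgt = k) = if i = k then iota R i else 0 := by
  split_ifs with h
  · exact Finsupp.filter_single_of_pos (fun b : Path => b.tgt = k) h
  · exact Finsupp.filter_single_of_neg (fun b : Path => b.tgt = k) h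

theorem mu_square_three (u : R) :
    mu u 0 [rho R 3 0, rho R 2 0, rho R 1 0, rho R 4 0] = u • iota R 0 := mu_square u 3

theorem mu_square_one (u : R) :
    mu u 0 [rho R 1 0, rho R 4 0, rho R 3 0, rho R 2 0] = u • iota R 0 := mu_square u 1

theorem mu_square_two (u : R) :
    mu u 0 [rho R 2 0, rho R 1 0, rho R 4 0, rho R 3 0] = u • iota R 1 := mu_square u 2

theorem mu_square_four (u : R) :
    mu u 0 [rho R 4 0, rho R 3 0, rho R 2 0, rho R 1 0] = u • iota R 1 := mu_square u 4

end

-- The three contributions and their cancellation.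

section
variable {R₁ R₂ : Type} [CommRing R₁] [CommRing R₂] [Algebra (ZMod 2) R₁] [Algebra (ZMod 2) R₂]
variable (Γ : WeightedAlgebraDiagonal) (u₁ : R₁) (u₂ : R₂)

/-- When one side runs through consecutive chords in increasing order, the reflected side runs
through them in decreasing order, which is the boundary of a square. This happens for four of the
`16` words, two for each side; the others contribute zero. -/
theorem structureTerm_four_zero : (dualizingBimodule R₁ R₂).structureTerm Γ u₁ u₂ 4 0 0 =
    Pi.single 0 ((rho R₁ 1 3 + rho R₁ 3 3) ⊗ₜ[ZMod 2] (u₂ • iota R₂ 0) +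
      (u₁ • iota R₁ 0) ⊗ₜ[ZMod 2] (rho R₂ 1 3 + rho R₂ 3 3)) := by
  rw [structureTerm_eq_tailSum, tailSum_short_zero Γ u₁ u₂ (by simp) (by simp)]
  iterate 2 rw [tailSum_short_one Γ u₁ u₂ (by decide) (by simp)]
  iterate 4 rw [tailSum_short_zero Γ u₁ u₂ (by decide) (by simp)]
  iterate 8 rw [tailSum_short_one Γ u₁ u₂ (by decide) (by simp)]
  simp only [List.nil_append, List.cons_append, tailSum_zero]
  iterate 16 rw [tensorOp_four Γ u₁ u₂ _ _ _ _ _ _ _ _ (by decide)]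
  simp +decide only [if_true, if_false, mu_square_three, mu_square_one, Pi.single_zero, add_zero, zero_add, tensorAt_eq,
    Finsupp.filter_smul, Finsupp.filter_zero, TensorProduct.zero_tmul, TensorProduct.tmul_zero,
    filter_rho, filter_iota, ← Pi.single_add]
  congr 1
  simp only [TensorProduct.add_tmul, TensorProduct.tmul_add]
  abel

theorem structureTerm_four_one : (dualizingBimodule R₁ R₂).structureTerm Γ u₁ u₂ 4 0 1 =
    Pi.single 1 ((rho R₁ 2 3 + rho R₁ 0 3) ⊗ₜ[ZMod 2] (u₂ • iota R₂ 1) +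
      (u₁ • iota R₁ 1) ⊗ₜ[ZMod 2] (rho R₂ 2 3 + rho R₂ 0 3)) := by
  rw [structureTerm_eq_tailSum, tailSum_short_one Γ u₁ u₂ (by simp) (by simp)]
  iterate 2 rw [tailSum_short_zero Γ u₁ u₂ (by decide) (by simp)]
  iterate 4 rw [tailSum_short_one Γ u₁ u₂ (by decide) (by simp)]
  iterate 8 rw [tailSum_short_zero Γ u₁ u₂ (by decide) (by simp)]
  simp only [List.nil_append, List.cons_append, tailSum_zero]
  iterate 16 rw [tensorOp_four Γ u₁ u₂ _ _ _ _ _ _ _ _ (by decide)]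
  simp +decide only [if_true, if_false, mu_square_two, mu_square_four, Pi.single_zero, add_zero, zero_add, tensorAt_eq,
    Finsupp.filter_smul, Finsupp.filter_zero, TensorProduct.zero_tmul, TensorProduct.tmul_zero,
    filter_rho, filter_iota, ← Pi.single_add]
  congr 1
  simp only [TensorProduct.add_tmul, TensorProduct.tmul_add]
  abel

/-- Two factors both have nonzero products only for a short pair and a long pair that complement
each other to full turns; the four such terms are the expansion of the stated tensor product. -/
theorem structureTerm_two_zero : (dualizingBimodule R₁ R₂).structureTerm Γ u₁ u₂ 2 0 0 =
    Pi.single 0 ((rho R₁ 1 3 + rho R₁ 3 3) ⊗ₜ[ZMod 2] (rho R₂ 1 3 + rho R₂ 3 3) :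
      Alg R₁ ⊗[ZMod 2] Alg R₂) := by
  rw [structureTerm_eq_tailSum]
  simp only [tailSum_succ_zero, tailSum_succ_one, tailSum_zero, List.nil_append, List.cons_append,
    List.map_cons, List.map_nil, tensorOp_two, chordPair, mu_rho_rho]
  simp +decide only [if_true, if_false, Pi.single_zero, add_zero, zero_add, tensorAt_eq,
    Finsupp.filter_zero, TensorProduct.zero_tmul, TensorProduct.tmul_zero,
    filter_rho, ← Pi.single_add]
  congr 1
  simp only [TensorProduct.add_tmul, TensorProduct.tmul_add]
  abel

theorem structureTerm_two_one : (dualizingBimodule R₁ R₂).structureTerm Γ u₁ u₂ 2 0 1 =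
    Pi.single 1 ((rho R₁ 2 3 + rho R₁ 0 3) ⊗ₜ[ZMod 2] (rho R₂ 2 3 + rho R₂ 0 3) :
      Alg R₁ ⊗[ZMod 2] Alg R₂) := by
  rw [structureTerm_eq_tailSum]
  simp only [tailSum_succ_zero, tailSum_succ_one, tailSum_zero, List.nil_append, List.cons_append,
    List.map_cons, List.map_nil, tensorOp_two, chordPair, mu_rho_rho]
  simp +decide only [if_true, if_false, Pi.single_zero, add_zero, zero_add, tensorAt_eq,
    Finsupp.filter_zero, TensorProduct.zero_tmul, TensorProduct.tmul_zero,
    filter_rho, ← Pi.single_add]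
  congr 1
  simp only [TensorProduct.add_tmul, TensorProduct.tmul_add, show (4 : ZMod 4) = 0 from rfl]
  abel

theorem structureTerm_zero_zero : (dualizingBimodule R₁ R₂).structureTerm Γ u₁ u₂ 0 1 0 =
    Pi.single 0 ((rho R₁ 1 3 + rho R₁ 3 3) ⊗ₜ[ZMod 2] (rho R₂ 1 3 + rho R₂ 3 3) +
      (u₁ • iota R₁ 0) ⊗ₜ[ZMod 2] (rho R₂ 1 3 + rho R₂ 3 3) +
      (rho R₁ 1 3 + rho R₁ 3 3) ⊗ₜ[ZMod 2] (u₂ • iota R₂ 0)) := by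
  simp only [DDData.structureTerm, DDData.iter, List.map_cons, List.map_nil, List.sum_cons,
    List.sum_nil, add_zero, tensorOp_zero, tensorAt_eq, mu_curvature, Finsupp.filter_add,
    Finsupp.filter_smul, filter_rho, filter_iota]
  simp +decide only [dualizingBimodule, if_true, if_false, add_zero, zero_add]

theorem structureTerm_zero_one : (dualizingBimodule R₁ R₂).structureTerm Γ u₁ u₂ 0 1 1 =
    Pi.single 1 ((rho R₁ 2 3 + rho R₁ 0 3) ⊗ₜ[ZMod 2] (rho R₂ 2 3 + rho R₂ 0 3) +
      (u₁ • iota R₁ 1) ⊗ₜ[ZMod 2] (rho R₂ 2 3 + rho R₂ 0 3) +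
      (rho R₁ 2 3 + rho R₁ 0 3) ⊗ₜ[ZMod 2] (u₂ • iota R₂ 1)) := by
  simp only [DDData.structureTerm, DDData.iter, List.map_cons, List.map_nil, List.sum_cons,
    List.sum_nil, add_zero, tensorOp_zero, tensorAt_eq, mu_curvature, Finsupp.filter_add,
    Finsupp.filter_smul, filter_rho, filter_iota]
  simp +decide only [dualizingBimodule, if_true, if_false, add_zero, zero_add]
  rw [add_comm (rho R₁ 0 3), add_comm (rho R₂ 0 3)]

/-- The structure equation for the dualizing bimodule, over any two versions of the torus algebra. -/
theorem dualizingBimodule_structureEquation :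
    (dualizingBimodule R₁ R₂).StructureEquation Γ u₁ u₂ := by
  classical
  intro x
  have hfin : ∀ m : ℕ × ℕ, m ∉ ({(0, 1), (2, 0), (4, 0)} : Finset (ℕ × ℕ)) →
      (dualizingBimodule R₁ R₂).structureTerm Γ u₁ u₂ m.1 m.2 x = 0 := by
    intro m hm
    refine List.sum_eq_zero fun v hv => ?_
    obtain ⟨q, hq, rfl⟩ := List.mem_map.1 hv
    obtain ⟨cs, h1, h2, h3⟩ := mem_iter hq
    rw [h3, tensorOp_eq_zero Γ u₁ u₂ hm h1 h2, Pi.single_zero]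
  constructor
  · refine Set.Finite.subset (Finset.finite_toSet {(0, 1), (2, 0), (4, 0)}) ?_
    rintro m ⟨q, hq, p, hp, hne⟩
    obtain ⟨cs, h1, h2, h3⟩ := mem_iter hq
    rw [h3] at hne
    exact pairOp_cases Γ hp h1 h2 hne
  · rw [finsum_eq_sum_of_support_subset (s := {(0, 1), (2, 0), (4, 0)}) _ fun m hm => by
      by_contra h
      exact hm (hfin m h)]
    rw [Finset.sum_insert (by decide), Finset.sum_insert (by decide), Finset.sum_singleton]
    -- The letters stand for `ρ ⊗ ρ`, `Uι ⊗ ρ` and `ρ ⊗ Uι`: the curvature contains each once, the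
    -- product repeats `a`, and the fourfold operation repeats `b` and `c`.
    have key : ∀ a b c : Alg R₁ ⊗[ZMod 2] Alg R₂, a + b + c + (a + (c + b)) = 0 := fun a b c => by
      rw [add_comm c b, ← add_assoc a b c, ← two_smul (ZMod 2), show (2 : ZMod 2) = 0 from rfl,
        zero_smul]
    obtain rfl | rfl : x = 0 ∨ x = 1 := by omega
    · rw [structureTerm_four_zero, structureTerm_two_zero, structureTerm_zero_zero,
        ← Pi.single_add, ← Pi.single_add, key, Pi.single_zero]
    · rw [structureTerm_four_one, structureTerm_two_one, structureTerm_zero_one,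
        ← Pi.single_add, ← Pi.single_add, key, Pi.single_zero]

end
end BorderedTorus

end

theorem lemma6p1 (Γ : BorderedTorus.WeightedAlgebraDiagonal) :
    BorderedTorus.uCFDD.StructureEquation Γ (Polynomial.X : Polynomial (ZMod 2))
        (Polynomial.X : Polynomial (ZMod 2)) ∧
      BorderedTorus.CFDD.StructureEquation Γ (1 : ZMod 2)
        (Polynomial.X : Polynomial (ZMod 2)) :=
  ⟨BorderedTorus.dualizingBimodule_structureEquation Γ _ _,
    BorderedTorus.dualizingBimodule_structureEquation Γ _ _⟩
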